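/- Let $K$ be a field with algebraic closure $\overline K$. Let $C$ and $D$ be smooth, projective, geometrically irreducible curves over $K$, and let $f\colon C\dashrightarrow D$ be a nonconstant separable rational map defined over $K$. Places of $C$ and $D$ are understood geometrically: a place of a smooth projective curve $X$ over $K$ is a $\overline K$-point of $X$, i.e. a valuation ring $K\subseteq\mathcal O\subsetneq K(X)$ together with a $K$-homomorphism $\mathcal O\to\overline K$ whose kernel is the maximal ideal of $\mathcal O$. A place $p$ of $C$ lies over its restriction along $f^*\colon K(D)\hookrightarrow K(C)$, and a place $q$ of $D$ with valuation ring $\mathcal O_q$ is tamely ramified in $f$ (unramified being allowed) if every valuation ring $\mathcal P$ of $K(C)$ with $\mathcal P\cap K(D)=\mathcal O_q$ has ramification index not divisible by $\operatorname{char}(K)$ and residue field separable over that of $\mathcal O_q$. Suppose that some place of $D$ is tamely ramified in $f$ and lies under at most two places of $C$. Let $$C\dashrightarrow A_1\dashrightarrow A_2\dashrightarrow\cdots\dashrightarrow D\qquad\text{and}\qquad C\dashrightarrow B_1\dashrightarrow B_2\dashrightarrow\cdots\dashrightarrow D$$ be two maximal decompositions of $f$ into rational maps, defined over $K$, of degree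 greater than $1$ between curves over $K$ (maximal means that none of the maps in them is a composition of two rational maps over $K$ of degree greater than $1$). Then the two decompositions have the same length, and the sequence of the degrees of the maps in the first is a permutation of the sequence of the degrees of the maps in the second. -/

import Mathlib

open CategoryTheory AlgebraicGeometry

universe u

noncomputable section

namespace JordanCurves

/-- For an integral scheme `X` over `Spec K`, the inclusion of `K` into the function field of `X`. -/
def constHom {K : Type u} [Field K] {X : Scheme.{u}} [IsIntegral X]
    (str : X ⟶ Spec (CommRingCat.of K)) : K →+* X.functionField :=
  ((Scheme.ΓSpecIso (CommRingCat.of K)).inv ≫ str.appTop ≫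
    X.presheaf.germ ⊤ (genericPoint X) trivial).hom

/-- A curve over the field `K`: an integral separated scheme of finite type over `Spec K` whose
function field has transcendence degree `1` over `K`. -/
structure Curve (K : Type u) [Field K] where
  /-- The underlying scheme. -/
  X : Scheme.{u}
  /-- The structure morphism. -/
  str : X ⟶ Spec (CommRingCat.of K)
  isIntegral : IsIntegral X
  isSeparated : IsSeparated str
  locallyOfFiniteType : LocallyOfFiniteType str
  quasiCompact : QuasiCompact str
  trdeg_eq_one :
    letI : Algebra K X.functionField := (constHom str).toAlgebra
    Algebra.trdeg K X.functionField = 1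

variable {K : Type u} [Field K]

attribute [instance] Curve.isIntegral

instance (C : Curve K) : C.X.Over (Spec (CommRingCat.of K)) := ⟨C.str⟩

/-- The function field `K(C)` of a curve. -/
abbrev Curve.FunctionField (C : Curve K) : Type u := C.X.functionField

/-- The inclusion of the field `K` of constants into the function field `K(C)`. -/
def Curve.const (C : Curve K) : K →+* C.FunctionField :=
  constHom C.str

/-- `C` is a smooth, projective, geometrically irreducible curve. (A curve is projective if and
only if it is proper.) -/
structure Curve.IsNice (C : Curve K) : Prop where
  smooth : Smooth C.str
  proper : IsProper C.str
  geometricallyIrreducible : GeometricallyIrreducible C.str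

/-- A nonconstant rational map `C ⤏ D` defined over `K`. A rational map between curves is
nonconstant if and only if it is dominant. -/
structure RatMap (C D : Curve K) where
  /-- The underlying rational map of schemes. -/
  map : C.X ⤏ D.X
  isDominant : map.IsDominant
  isOver : map.IsOver (Spec (CommRingCat.of K))

attribute [instance] RatMap.isDominant RatMap.isOver

/-- The composite of `f : C ⤏ D` followed by `g : D ⤏ E`. -/
def RatMap.comp {C D E : Curve K} (f : RatMap C D) (g : RatMap D E) : RatMap C E where
  map := f.map.comp g.map
  isDominant := inferInstance
  isOver := inferInstance

/-- A dominant rational map sends the generic point to the generic point. -/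
lemma fromFunctionField_closedPoint {X Y : Scheme.{u}} [IsIntegral X] [IsIntegral Y]
    (f : X ⤏ Y) [f.IsDominant] :
    f.fromFunctionField (IsLocalRing.closedPoint X.functionField) = genericPoint Y := by
  obtain ⟨φ, rfl⟩ := f.exists_rep
  have hφ : IsDominant φ.hom := (φ.isDominant_toRationalMap_iff).mp inferInstance
  have hmem : genericPoint X ∈ φ.domain :=
    (genericPoint_specializes _).mem_open φ.domain.2 φ.dense_domain.nonempty.choose_spec
  have : Nonempty φ.domain := ⟨⟨_, hmem⟩⟩
  have hc := Scheme.fromSpecStalk_closedPoint (X := X) (x := genericPoint X)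
  rw [Scheme.RationalMap.fromFunctionField_toRationalMap]
  change (φ.domain.fromSpecStalkOfMem (genericPoint X) hmem ≫ φ.hom) _ = _
  generalize (IsLocalRing.closedPoint X.functionField : Spec X.functionField) = c at hc ⊢
  have hu : φ.domain.fromSpecStalkOfMem (genericPoint X) hmem c =
      genericPoint φ.domain.toScheme := by
    apply φ.domain.ι.isOpenEmbedding.injective
    rw [genericPoint_eq_of_isOpenImmersion φ.domain.ι]
    rw [← Scheme.Opens.fromSpecStalkOfMem_ι φ.domain (genericPoint X) hmem] at hc
    exact hc
  refine (congrArg φ.hom hu).trans ?_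
  refine IsGenericPoint.eq (S := Set.univ) ?_ (genericPoint_spec Y)
  have h := (genericPoint_spec φ.domain.toScheme).image φ.hom.continuous
  rw [Set.image_univ, φ.hom.denseRange.closure_eq] at h
  exact h

/-- The inclusion `f^* : K(D) → K(C)` of function fields induced by `f : C ⤏ D`. -/
def RatMap.pullback {C D : Curve K} (f : RatMap C D) : D.FunctionField →+* C.FunctionField :=
  (D.X.presheaf.stalkSpecializes
      (specializes_of_eq (fromFunctionField_closedPoint f.map)) ≫
    Scheme.stalkClosedPointTo f.map.fromFunctionField).hom

/-- The degree `[K(C) : K(D)]` of a nonconstant rational map. -/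
def RatMap.degree {C D : Curve K} (f : RatMap C D) : ℕ :=
  letI := f.pullback.toAlgebra
  Module.finrank D.FunctionField C.FunctionField

/-- `f : C ⤏ D` is separable: the extension `K(C) / K(D)` is separable. -/
def RatMap.IsSeparable {C D : Curve K} (f : RatMap C D) : Prop :=
  letI := f.pullback.toAlgebra
  Algebra.IsSeparable D.FunctionField C.FunctionField

/-- `f` is indecomposable: it has degree greater than `1`, and it is not a composite of two
rational maps of degree greater than `1`. -/
def RatMap.IsIndecomposable {C D : Curve K} (f : RatMap C D) : Prop :=
  1 < f.degree ∧
    ∀ (A : Curve K) (g : RatMap C A) (h : RatMap A D),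
      f = g.comp h → ¬ (1 < g.degree ∧ 1 < h.degree)

/-- `IsMaximalDecomposition f l`: there is a decomposition `C ⤏ A₁ ⤏ A₂ ⤏ ⋯ ⤏ D` of `f` into
rational maps of degree greater than `1` that cannot be refined (so that all its maps are
indecomposable), and `l` is the list of the degrees of its maps, in this order. -/
inductive IsMaximalDecomposition : {C D : Curve K} → RatMap C D → List ℕ → Prop
  | single {C D : Curve K} (f : RatMap C D) (hf : f.IsIndecomposable) :
      IsMaximalDecomposition f [f.degree]
  | cons {C A D : Curve K} (g : RatMap C A) (h : RatMap A D) (l : List ℕ)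
      (hg : g.IsIndecomposable) (hh : IsMaximalDecomposition h l) :
      IsMaximalDecomposition (g.comp h) (g.degree :: l)

/-! ### Ramification of places (valuation rings) in an extension `φ : F → E` of fields -/

section Ramification

variable {F E : Type u} [Field F] [Field E] (φ : F →+* E) (P : ValuationSubring E)

/-- The inclusion of the valuation ring of `F` below `P` into `P`. -/
def belowHom : P.comap φ →+* P :=
  φ.restrict (P.comap φ) P fun _ hx => hx

instance : IsLocalHom (belowHom φ P) where
  map_nonunit := by
    rintro ⟨x, hx⟩ h
    obtain ⟨⟨y, hy⟩, hxy⟩ := h.exists_right_inv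
    have hxy' : φ x * y = 1 := congrArg Subtype.val hxy
    have hy' : y = φ x⁻¹ := by
      rw [map_inv₀]
      exact eq_inv_of_mul_eq_one_right hxy'
    have hx0 : x ≠ 0 := by
      rintro rfl
      simp at hxy'
    refine IsUnit.of_mul_eq_one ⟨x⁻¹, show φ x⁻¹ ∈ P from hy' ▸ hy⟩ ?_
    exact Subtype.ext (mul_inv_cancel₀ hx0)

/-- The ramification index of `P` in `E / F`: the index of the value group `Fˣ / (P ∩ F)ˣ` in the
value group `Eˣ / Pˣ` (with the value `0` if this index is infinite). -/
def ramificationIndex : ℕ :=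
  ((Units.map (φ : F →* E)).range ⊔ P.unitGroup).index

/-- `P` is tamely ramified (possibly unramified) in `E / F`: the ramification index is not
divisible by the characteristic, and the extension of residue fields is separable. -/
def IsTameAt : Prop :=
  (ramificationIndex φ P : F) ≠ 0 ∧
    letI := (IsLocalRing.ResidueField.map (belowHom φ P)).toAlgebra
    Algebra.IsSeparable (IsLocalRing.ResidueField (P.comap φ)) (IsLocalRing.ResidueField P)

end Ramification

/-- A (geometric) place of the curve `C` over `K`, that is, a `K̄`-valued place of the function
field `K(C)`, trivial on the constants: a valuation ring `K ⊆ 𝒪 ⊊ K(C)` together with a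
`K`-homomorphism `𝒪 → K̄` whose kernel is the maximal ideal of `𝒪`. If `C` is smooth and projective,
then these are the points of `C` over `K̄`. -/
structure Place (C : Curve K) where
  /-- The valuation ring of the place. -/
  ring : ValuationSubring C.FunctionField
  const_mem : ∀ c : K, C.const c ∈ ring
  ne_top : ring ≠ ⊤
  /-- The residue map, which evaluates functions at the place. -/
  eval : ring →+* AlgebraicClosure K
  isLocalHom : IsLocalHom eval
  eval_const : ∀ c : K, eval ⟨C.const c, const_mem c⟩ = algebraMap K (AlgebraicClosure K) c

/-- The place `p` of `C` lies over the place `q` of `D` with respect to `f : C ⤏ D`: `q` is the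
restriction of `p` along `f^*`. -/
def Place.LiesOver {C D : Curve K} (f : RatMap C D) (p : Place C) (q : Place D) : Prop :=
  p.ring.comap f.pullback = q.ring ∧
    ∀ (x : D.FunctionField) (hq : x ∈ q.ring) (hp : f.pullback x ∈ p.ring),
      p.eval ⟨f.pullback x, hp⟩ = q.eval ⟨x, hq⟩

/-- The place `q` of `D` is tamely ramified in `f : C ⤏ D`: all valuation rings of `K(C)` above
that of `q` are tamely ramified. -/
def Place.IsTame {C D : Curve K} (f : RatMap C D) (q : Place D) : Prop :=
  ∀ P : ValuationSubring C.FunctionField, P.comap f.pullback = q.ring → IsTameAt f.pullback P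

end JordanCurves

end

/-! Rational maps between curves over `K` are the same as `K`-embeddings of function fields in the
other direction, and every intermediate field of `K(C) / K(D)` is again the function field of a
curve. Let `L` be a finite Galois extension of `K(D)` containing `K(C)`, and put `G = Gal(L/K(D))`,
`H = Gal(L/K(C))`. A maximal decomposition of `f` then becomes a maximal chain of subgroups from `H`
to `G`, with degrees turning into indices (`galSubgroup_covBy`, `IsMaximalDecomposition.maxChain`).

The tame place `q` yields a cyclic `Z ≤ G` and an `x` with `G = Z H ∪ Z x H`
(`exists_isCyclic_twoCosets`). Extend `q` to a `K̄`-valued place of `L` with inertia group `I`.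
Restricting it along the embeddings `σ : K(C) → L` gives places of `C` over `q`, and if `σ`, `τ`
give the same place then `τ ∈ I σ H`. Hence at most two double cosets occur. The quotient of `I` by
wild inertia is cyclic, generated by the class of some `g`. Since all valuation rings over `q` are
tame, every conjugate of wild inertia lies in `H` (`mem_galSubgroup_of_mem_wildInertia`), so `I` may
be replaced by `Z = ⟨g⟩`.

What remains is group theory (`MaxChain.unique`). As in the Jordan–Hölder theorem, it suffices to
compare two distinct maximal subgroups `A`, `B` of `T` that contain `H` (`covBy_inf_and_relIndex`).
If `T = A B`, then `A ∩ B` is maximal in both, and opposite sides of the square have the same index.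
Otherwise `A` and `B` both meet both double cosets, `A ∩ B` has index 2 in each of them, and `[T :
A] = [T : B]`. In both cases the two ways around the square have the same multiset of indices. -/

namespace TwoOrbits

/-! ### Groups covered by two double cosets of a cyclic subgroup -/

variable {Γ : Type*} [Group Γ]

/-- A set containing `1` that is stable under right multiplication by `A` and `B` contains
`A ⊔ B`. -/
lemma mem_of_mem_sup {A B : Subgroup Γ} {S : Set Γ} (h1 : 1 ∈ S)
    (hA : ∀ s ∈ S, ∀ a ∈ A, s * a ∈ S) (hB : ∀ s ∈ S, ∀ b ∈ B, s * b ∈ S) {t : Γ}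
    (ht : t ∈ A ⊔ B) : t ∈ S := by
  let R : Subgroup Γ :=
    { carrier := {t | ∀ s, s ∈ S ↔ s * t ∈ S}
      one_mem' := by simp
      mul_mem' := by
        intro a b ha hb s
        rw [ha s, hb (s * a), mul_assoc]
      inv_mem' := by
        intro a ha s
        rw [ha (s * a⁻¹)]
        simp }
  have key : ∀ C : Subgroup Γ, (∀ s ∈ S, ∀ a ∈ C, s * a ∈ S) → C ≤ R := by
    intro C hC a ha s
    refine ⟨fun hs => hC s hs a ha, fun hs => ?_⟩
    simpa using hC _ hs a⁻¹ (C.inv_mem ha)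
  have : t ∈ R := (sup_le (key A hA) (key B hB)) ht
  simpa using (this 1).1 h1

/-- The stabilizer in `T` of the set `A * B`. -/
def mulStabilizer (T A B : Subgroup Γ) : Subgroup Γ where
  carrier := {t | t ∈ T ∧ ∀ s, (∃ a ∈ A, ∃ b ∈ B, s = a * b) ↔ ∃ a ∈ A, ∃ b ∈ B, t * s = a * b}
  one_mem' := by simp [T.one_mem]
  mul_mem' := by
    rintro a b ⟨ha, ha'⟩ ⟨hb, hb'⟩
    refine ⟨T.mul_mem ha hb, fun s => ?_⟩
    rw [hb' s, ha' (b * s), mul_assoc]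
  inv_mem' := by
    rintro a ⟨ha, ha'⟩
    refine ⟨T.inv_mem ha, fun s => ?_⟩
    rw [ha' (a⁻¹ * s)]
    simp

lemma ncard_orbit (A B N : Subgroup Γ) (y : Γ) (hN : ∀ a ∈ A, a ∈ N ↔ y⁻¹ * a * y ∈ B) :
    (MulAction.orbit A (y : Γ ⧸ B)).ncard = N.relIndex A := by
  rw [← MulAction.index_stabilizer, Subgroup.relIndex]
  congr 1
  ext ⟨a, ha⟩
  rw [MulAction.mem_stabilizer_iff, Subgroup.mem_subgroupOf, hN a ha]
  change (((a * y : Γ) : Γ ⧸ B) = (y : Γ ⧸ B)) ↔ _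
  rw [eq_comm, QuotientGroup.eq, mul_assoc]

/-- If `T = A B` then `[A : A ∩ B] = [T : B]`. -/
lemma relIndex_eq_of_mul {A B T : Subgroup Γ} (hA : A ≤ T)
    (h : ∀ t ∈ T, ∃ a ∈ A, ∃ b ∈ B, t = a * b) : B.relIndex A = B.relIndex T := by
  rw [← ncard_orbit A B B 1 (by simp), ← ncard_orbit T B B 1 (by simp)]
  congr 1
  apply Set.Subset.antisymm
  · rintro _ ⟨⟨a, ha⟩, rfl⟩
    exact ⟨⟨a, hA ha⟩, rfl⟩
  · rintro _ ⟨⟨t, ht⟩, rfl⟩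
    obtain ⟨a, ha, b, hb, rfl⟩ := h t ht
    refine ⟨⟨a, ha⟩, ?_⟩
    change (((a * 1 : Γ) : Γ ⧸ B)) = ((a * b * 1 : Γ) : Γ ⧸ B)
    rw [QuotientGroup.eq]
    simpa using hb

/-- If `x B = N x H` then `[B : H] = [N : N ∩ x H x⁻¹]`. -/
lemma relIndex_eq_of_conj {B H N M : Subgroup Γ} (x : Γ)
    (hN : ∀ z ∈ N, x⁻¹ * z * x ∈ B) (hB : ∀ b ∈ B, ∃ z ∈ N, ∃ h ∈ H, x * b = z * x * h)
    (hM : ∀ z ∈ N, z ∈ M ↔ x⁻¹ * z * x ∈ H) : H.relIndex B = M.relIndex N := by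
  rw [← ncard_orbit B H H 1 (by simp), ← ncard_orbit N H M x hM]
  refine Set.ncard_congr (fun q _ => x • q) ?_ ?_ ?_
  · rintro _ ⟨⟨b, hb⟩, rfl⟩
    obtain ⟨z, hz, h, hh, e⟩ := hB b hb
    refine ⟨⟨z, hz⟩, ?_⟩
    change (((z * x : Γ) : Γ ⧸ H)) = ((x * (b * 1) : Γ) : Γ ⧸ H)
    rw [QuotientGroup.eq, mul_one, e]
    simpa [mul_assoc] using hh
  · intro a b _ _ h
    exact smul_left_cancel x h
  · rintro _ ⟨⟨z, hz⟩, rfl⟩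
    refine ⟨((x⁻¹ * z * x : Γ) : Γ ⧸ H), ⟨⟨_, hN z hz⟩, ?_⟩, ?_⟩
    · change (((x⁻¹ * z * x * 1 : Γ) : Γ ⧸ H)) = _
      rw [mul_one]
    · change ((x * (x⁻¹ * z * x) : Γ) : Γ ⧸ H) = ((z * x : Γ) : Γ ⧸ H)
      congr 1
      group

/-- The equation `z ^ n = 1` has at most `n` solutions in a cyclic group, so a subgroup of order `n`
is exactly its solution set. -/
lemma eq_of_card_eq_of_isCyclic [Finite Γ] {Z P Q : Subgroup Γ} [IsCyclic Z] (hP : P ≤ Z)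
    (hQ : Q ≤ Z) (h : Nat.card P = Nat.card Q) : P = Q := by
  classical
  have := Fintype.ofFinite Z
  have key : ∀ R : Subgroup Γ, R ≤ Z →
      (R : Set Γ) = Subtype.val '' {z : Z | z ^ Nat.card R = 1} := by
    intro R hR
    symm
    apply (Set.eq_of_subset_of_ncard_le ?_ ?_ (Set.toFinite _)).symm
    · intro r hr
      refine ⟨⟨r, hR hr⟩, ?_, rfl⟩
      have : (⟨r, hr⟩ : R) ^ Nat.card R = 1 := pow_card_eq_one'
      exact Subtype.ext (by simpa only [SubmonoidClass.coe_pow, OneMemClass.coe_one] using congrArg (Subtype.val : R → Γ) this)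
    · rw [Set.ncard_image_of_injective _ Subtype.val_injective]
      have := IsCyclic.card_pow_eq_one_le (α := Z) (n := Nat.card R) Nat.card_pos
      rw [← Set.ncard_coe_finset] at this
      simpa [← Nat.card_coe_set_eq] using this
  apply SetLike.coe_injective
  rw [key P hP, key Q hQ, h]

/-- The product set `A B` contains `t`. -/
def InProd (A B : Subgroup Γ) (t : Γ) : Prop := ∃ a ∈ A, ∃ b ∈ B, t = a * b

/-- `T` is contained in the union of the double cosets `Z H` and `Z x H`. -/
def TwoCosets (Z H T : Subgroup Γ) (x : Γ) : Prop :=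
  ∀ t ∈ T, InProd Z H t ∨ ∃ z ∈ Z, ∃ h ∈ H, t = z * x * h

/-- Any element outside `Z H` represents the second double coset, so the representative can be moved
into whichever subgroup meets that coset. -/
lemma TwoCosets.change {Z H T : Subgroup Γ} {x y : Γ} (h : TwoCosets Z H T x) (hy : y ∈ T)
    (hy' : ¬ InProd Z H y) : TwoCosets Z H T y := by
  obtain ⟨z₀, hz₀, h₀, hh₀, e⟩ := (h y hy).resolve_left hy'
  intro t ht
  refine (h t ht).imp_right ?_
  rintro ⟨z, hz, k, hk, rfl⟩
  refine ⟨z * z₀⁻¹, Z.mul_mem hz (Z.inv_mem hz₀), h₀⁻¹ * k, H.mul_mem (H.inv_mem hh₀) hk, ?_⟩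
  rw [e]
  group

lemma relIndex_eq_of_inProd {Z A T : Subgroup Γ} (hZ : Z ≤ T) (h : ∀ t ∈ T, InProd Z A t) :
    A.relIndex Z = A.relIndex T :=
  relIndex_eq_of_mul hZ h

section

variable {Z H T A B : Subgroup Γ} {x : Γ}

lemma inProd_comm (h : ∀ t ∈ T, InProd A B t) : ∀ t ∈ T, InProd B A t := by
  intro t ht
  obtain ⟨a, ha, b, hb, e⟩ := h t⁻¹ (T.inv_mem ht)
  exact ⟨b⁻¹, B.inv_mem hb, a⁻¹, A.inv_mem ha, by rw [← inv_inv t, e, mul_inv_rev]⟩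

/-- If `x ∈ A` then `Z A = T`. -/
lemma TwoCosets.inProd (h : TwoCosets Z H T x) (hHA : H ≤ A) (hx : x ∈ A) :
    ∀ t ∈ T, InProd Z A t := by
  intro t ht
  obtain ⟨z, hz, k, hk, rfl⟩ | ⟨z, hz, k, hk, rfl⟩ := h t ht
  · exact ⟨z, hz, k, hHA hk, rfl⟩
  · exact ⟨z, hz, x * k, A.mul_mem hx (hHA hk), by group⟩

/-- Once `x ∈ A`, the factor from `Z` is a product of elements of `A`. The covering of `T` therefore
restricts to `A = (Z ∩ A) H ∪ (Z ∩ A) x H`. -/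
lemma TwoCosets.mem_cases (h : TwoCosets Z H T x) (hHA : H ≤ A) (hx : x ∈ A) (hA : A ≤ T) {t : Γ}
    (ht : t ∈ A) : ∃ z ∈ Z, z ∈ A ∧ ∃ k ∈ H, t = z * k ∨ t = z * x * k := by
  obtain ⟨z, hz, k, hk, rfl⟩ | ⟨z, hz, k, hk, rfl⟩ := h t (hA ht)
  · refine ⟨z, hz, ?_, k, hk, Or.inl rfl⟩
    simpa using A.mul_mem ht (A.inv_mem (hHA hk))
  · refine ⟨z, hz, ?_, k, hk, Or.inr rfl⟩
    simpa [mul_assoc] using A.mul_mem ht (A.inv_mem (A.mul_mem hx (hHA hk)))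

lemma comm_of_isCyclic [IsCyclic Z] {a b : Γ} (ha : a ∈ Z) (hb : b ∈ Z) : a * b = b * a := by
  let := IsCyclic.commGroup (α := Z)
  exact congrArg Subtype.val (mul_comm (⟨a, ha⟩ : Z) ⟨b, hb⟩)

/-- The case in which `A` meets both double cosets and `B` meets only one of them. -/
lemma inProd_of_subset [Finite Γ] [IsCyclic Z] (hB : B ≤ T)
    (hAB : A ⊔ B = T) (hx : x ∈ A) (hxH : ¬ InProd Z (A ⊓ B) x)
    (hT : TwoCosets Z (A ⊓ B) T x) (hBZ : ∀ b ∈ B, InProd Z (A ⊓ B) b) :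
    ∀ t ∈ T, InProd B A t := by
  have hA : A ≤ T := hAB ▸ le_sup_left
  -- `B'` plays for the coset of `x` the role that `Z ∩ B` plays for the trivial one: `x B = B' x (A
  -- ∩ B)`, while `B = (Z ∩ B) (A ∩ B)`.
  let B' : Subgroup Γ := (B.map (MulAut.conj x).toMonoidHom) ⊓ Z
  have hB' : ∀ z, z ∈ B' ↔ x⁻¹ * z * x ∈ B ∧ z ∈ Z := by
    intro z
    rw [Subgroup.mem_inf, Subgroup.mem_map_equiv]
    simp
  have hxB : ∀ b ∈ B, ∃ z ∈ B', ∃ h ∈ A ⊓ B, x * b = z * x * h := by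
    intro b hb
    obtain ⟨z, hz, h, hh, e⟩ | ⟨z, hz, h, hh, e⟩ := hT (x * b) (T.mul_mem (hA hx) (hB hb))
    · obtain ⟨z', hz', h', hh', e'⟩ := hBZ (h * b⁻¹) (B.mul_mem hh.2 (B.inv_mem hb))
      refine (hxH ⟨z * z', Z.mul_mem hz hz', h', hh', ?_⟩).elim
      rw [mul_assoc, ← e', ← mul_assoc, ← e]
      group
    · refine ⟨z, (hB' z).2 ⟨?_, hz⟩, h, hh, e⟩
      have : x⁻¹ * z * x = b * h⁻¹ := by
        rw [eq_mul_inv_iff_mul_eq, mul_assoc, mul_assoc, ← mul_assoc z, ← e]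
        group
      rw [this]
      exact B.mul_mem hb (B.inv_mem hh.2)
  -- the classes of `B` in both double cosets have the same size
  have h1 : (A ⊓ B).relIndex B = A.relIndex (Z ⊓ B) := by
    refine relIndex_eq_of_conj 1 ?_ ?_ ?_
    · rintro z ⟨_, hz⟩
      simpa using hz
    · intro b hb
      obtain ⟨z, hz, h, hh, rfl⟩ := hBZ b hb
      refine ⟨z, ⟨hz, ?_⟩, h, hh, by simp⟩
      simpa using B.mul_mem hb (B.inv_mem hh.2)
    · rintro z ⟨_, hz⟩
      simp only [inv_one, one_mul, mul_one, Subgroup.mem_inf]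
      exact ⟨fun h => ⟨h, hz⟩, fun h => h.1⟩
  have h2 : (A ⊓ B).relIndex B = A.relIndex B' := by
    refine relIndex_eq_of_conj x (fun z hz => ((hB' z).1 hz).1) hxB ?_
    intro z hz
    rw [Subgroup.mem_inf]
    refine ⟨fun h => ⟨A.mul_mem (A.mul_mem (A.inv_mem hx) h) hx, ((hB' z).1 hz).1⟩, fun h => ?_⟩
    have := A.mul_mem (A.mul_mem hx h.1) (A.inv_mem hx)
    simpa [mul_assoc] using this
  -- `Z = (Z ∩ A) (Z ∩ B) B'`
  have hS : ∀ t ∈ T, ∃ b ∈ Z ⊓ B, ∃ b' ∈ B', ∃ a ∈ A, t = b * b' * a := by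
    intro t ht
    rw [← hAB] at ht
    refine mem_of_mem_sup (S := {t | ∃ b ∈ Z ⊓ B, ∃ b' ∈ B', ∃ a ∈ A, t = b * b' * a})
      ⟨1, one_mem _, 1, one_mem _, 1, one_mem _, by simp⟩ ?_ ?_ ht
    · rintro _ ⟨b, hb, b', hb', a, ha, rfl⟩ a' ha'
      exact ⟨b, hb, b', hb', a * a', A.mul_mem ha ha', by group⟩
    · rintro _ ⟨b, hb, b', hb', a, ha, rfl⟩ c hc
      have hb'Z : b' ∈ Z := hb'.2
      obtain ⟨z, hz, hzA, k, hk, rfl | rfl⟩ := hT.mem_cases inf_le_left hx hA ha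
      · obtain ⟨z', hz', k', hk', e⟩ := hBZ (k * c) (B.mul_mem hk.2 hc)
        have hz'B : z' ∈ B := by
          have : z' = k * c * k'⁻¹ := by rw [e]; group
          rw [this]
          exact B.mul_mem (B.mul_mem hk.2 hc) (B.inv_mem hk'.2)
        refine ⟨b * z', mul_mem hb ⟨hz', hz'B⟩, b', hb', z * k', A.mul_mem hzA hk'.1, ?_⟩
        have e1 : z * z' = z' * z := comm_of_isCyclic hz hz'
        have e2 : b' * z' = z' * b' := comm_of_isCyclic hb'Z hz'
        calc b * b' * (z * k) * c = b * b' * z * (k * c) := by group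
          _ = b * b' * (z * z') * k' := by rw [e]; group
          _ = b * (b' * z') * z * k' := by rw [e1]; group
          _ = _ := by rw [e2]; group
      · obtain ⟨z', hz', k', hk', e⟩ := hxB (k * c) (B.mul_mem hk.2 hc)
        refine ⟨b, hb, b' * z', mul_mem hb' hz', z * x * k',
          A.mul_mem (A.mul_mem hzA hx) hk'.1, ?_⟩
        have e1 : z * z' = z' * z := comm_of_isCyclic hz hz'.2
        calc b * b' * (z * x * k) * c = b * b' * z * (x * (k * c)) := by group
          _ = b * b' * (z * z') * x * k' := by rw [e]; group
          _ = _ := by rw [e1]; group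
  have hcomm : ∀ {N : Subgroup Γ}, N ≤ Z → ∀ t ∈ (Z ⊓ A) ⊔ N, InProd N (Z ⊓ A) t := by
    intro N hN t ht
    refine mem_of_mem_sup (S := {t | InProd N (Z ⊓ A) t}) ⟨1, one_mem _, 1, one_mem _, by simp⟩
      ?_ ?_ ht
    · rintro _ ⟨n, hn, a, ha, rfl⟩ a' ha'
      exact ⟨n, hn, a * a', mul_mem ha ha', by group⟩
    · rintro _ ⟨n, hn, a, ha, rfl⟩ n' hn'
      refine ⟨n * n', mul_mem hn hn', a, ha, ?_⟩
      rw [mul_assoc, comm_of_isCyclic ha.1 (hN hn')]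
      group
  have hidx : ∀ {N : Subgroup Γ}, N ≤ Z →
      Nat.card ((Z ⊓ A) ⊔ N : Subgroup Γ) = Nat.card (Z ⊓ A : Subgroup Γ) * A.relIndex N := by
    intro N hN
    have e : A.relIndex N = (Z ⊓ A).relIndex N := by
      rw [← Subgroup.inf_relIndex_right A, ← Subgroup.inf_relIndex_right (Z ⊓ A)]
      congr 1
      rw [inf_right_comm, inf_eq_right.2 hN, inf_comm]
    rw [e, relIndex_eq_of_mul le_sup_right (hcomm hN)]
    rw [← Subgroup.relIndex_bot_left, ← Subgroup.relIndex_bot_left,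
      Subgroup.relIndex_mul_relIndex _ _ _ bot_le le_sup_left]
  -- Both subgroups of the cyclic group `Z` have order `|Z ∩ A| · [B : A ∩ B]`, so they coincide.
  -- This absorbs `B'` into `(Z ∩ B) (Z ∩ A)` and turns `T = (Z ∩ B) B' A` into `T = B A`.
  have heq : (Z ⊓ A) ⊔ (Z ⊓ B) = (Z ⊓ A) ⊔ B' := by
    refine eq_of_card_eq_of_isCyclic (Z := Z) (sup_le inf_le_left inf_le_left)
      (sup_le inf_le_left inf_le_right) ?_
    rw [hidx inf_le_left, hidx (N := B') inf_le_right, ← h1, ← h2]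
  intro t ht
  obtain ⟨b, hb, b', hb', a, ha, rfl⟩ := hS t ht
  have : b' ∈ (Z ⊓ A) ⊔ (Z ⊓ B) := heq ▸ (le_sup_right : B' ≤ _) hb'
  obtain ⟨c, hc, d, hd, rfl⟩ := hcomm inf_le_left b' this
  exact ⟨b * c, B.mul_mem hb.2 hc.2, d * a, A.mul_mem hd.2 ha, by group⟩

/-- The case in which both `A` and `B` meet both double cosets. -/
lemma inProd_or_inf_le [IsCyclic Z] (hA : A ⋖ T) (hB : B ≤ T) (hx : x ∈ A)
    (hT : TwoCosets Z (A ⊓ B) T x) {z : Γ} (hz : z ∈ Z) (hzx : z * x ∈ B) :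
    (∀ t ∈ T, InProd A B t) ∨ Z ⊓ B ≤ A := by
  -- As `A` is maximal, the left stabilizer of `A B` is `A` or `T`. If it is `T`, then `A B = T`. If
  -- it is `A`, it suffices that `Z ∩ B` stabilizes `A B`; this holds because `β ∈ Z ∩ B` commutes
  -- with `Z`, whence `x⁻¹ β x = (z x)⁻¹ β (z x) ∈ B`.
  have hle : A ≤ mulStabilizer T A B := by
    intro a ha
    refine ⟨hA.le ha, fun s => ⟨?_, ?_⟩⟩
    · rintro ⟨c, hc, d, hd, rfl⟩
      exact ⟨a * c, A.mul_mem ha hc, d, hd, by group⟩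
    · rintro ⟨c, hc, d, hd, e⟩
      exact ⟨a⁻¹ * c, A.mul_mem (A.inv_mem ha) hc, d, hd, by rw [mul_assoc, ← e]; group⟩
  rcases hA.eq_or_eq hle (fun t ht => ht.1) with h | h
  · right
    have key : ∀ β ∈ Z ⊓ B, ∀ s, InProd A B s → InProd A B (β * s) := by
      rintro β ⟨hβZ, hβB⟩ _ ⟨a, ha, b, hb, rfl⟩
      obtain ⟨α, hα, hαA, k, hk, rfl | rfl⟩ := hT.mem_cases inf_le_left hx hA.le ha
      · refine ⟨α, hαA, β * k * b, B.mul_mem (B.mul_mem hβB hk.2) hb, ?_⟩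
        calc β * (α * k * b) = (β * α) * k * b := by group
          _ = _ := by rw [comm_of_isCyclic hβZ hα]; group
      · refine ⟨α * x, A.mul_mem hαA hx, (z * x)⁻¹ * β * (z * x) * k * b, B.mul_mem (B.mul_mem
          (B.mul_mem (B.mul_mem (B.inv_mem hzx) hβB) hzx) hk.2) hb, ?_⟩
        have e1 : β * α = α * β := comm_of_isCyclic hβZ hα
        have e2 : z⁻¹ * β = β * z⁻¹ := comm_of_isCyclic (Z.inv_mem hz) hβZ
        calc β * (α * x * k * b) = (β * α) * x * k * b := by group
          _ = α * (β * z⁻¹) * (z * x) * k * b := by rw [e1]; group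
          _ = _ := by rw [← e2]; group
    intro β hβ
    rw [← h]
    refine ⟨hB hβ.2, fun s => ⟨key β hβ s, fun hs => ?_⟩⟩
    simpa [InProd] using key β⁻¹ (inv_mem hβ) _ hs
  · left
    intro t ht
    rw [← h] at ht
    simpa [InProd] using (ht.2 1).1 ⟨1, A.one_mem, 1, B.one_mem, by simp⟩

/-- Either `B A = T`, or both groups meet both double cosets and `Z ∩ A ≤ B`. -/
lemma inProd_or_exists [Finite Γ] [IsCyclic Z] (hB : B ⋖ T) (hAB : A ⊔ B = T)
    (hT : TwoCosets Z (A ⊓ B) T x) :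
    (∀ t ∈ T, InProd B A t) ∨ ∃ y ∈ A, ∃ z ∈ Z, ¬ InProd Z (A ⊓ B) y ∧ z * y ∈ B ∧
      TwoCosets Z (A ⊓ B) T y ∧ Z ⊓ A ≤ B := by
  have hA : A ≤ T := hAB ▸ le_sup_left
  by_cases hAZ : ∀ a ∈ A, InProd Z (A ⊓ B) a
  · by_cases hBZ : ∀ b ∈ B, InProd Z (A ⊓ B) b
    · -- then `T = Z (A ∩ B)`
      left
      have hTZ : ∀ t ∈ T, InProd Z (A ⊓ B) t := by
        intro t ht
        rw [← hAB] at ht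
        refine mem_of_mem_sup (S := {t | InProd Z (A ⊓ B) t}) ⟨1, one_mem _, 1, one_mem _, by simp⟩
          ?_ ?_ ht
        · rintro _ ⟨z, hz, k, hk, rfl⟩ a ha
          obtain ⟨z', hz', k', hk', e⟩ := hAZ (k * a) (A.mul_mem hk.1 ha)
          exact ⟨z * z', mul_mem hz hz', k', hk', by rw [mul_assoc, e]; group⟩
        · rintro _ ⟨z, hz, k, hk, rfl⟩ b hb
          obtain ⟨z', hz', k', hk', e⟩ := hBZ (k * b) (B.mul_mem hk.2 hb)
          exact ⟨z * z', mul_mem hz hz', k', hk', by rw [mul_assoc, e]; group⟩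
      have hS : ∀ t ∈ T, ∃ b ∈ Z ⊓ B, ∃ a ∈ Z ⊓ A, ∃ k ∈ A ⊓ B, t = b * a * k := by
        intro t ht
        rw [← hAB] at ht
        refine mem_of_mem_sup (S := {t | ∃ b ∈ Z ⊓ B, ∃ a ∈ Z ⊓ A, ∃ k ∈ A ⊓ B, t = b * a * k})
          ⟨1, one_mem _, 1, one_mem _, 1, one_mem _, by simp⟩ ?_ ?_ ht
        · rintro _ ⟨b, hb, a, ha, k, hk, rfl⟩ c hc
          obtain ⟨z', hz', k', hk', e⟩ := hAZ (k * c) (A.mul_mem hk.1 hc)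
          have hz'A : z' ∈ A := by
            have : z' = k * c * k'⁻¹ := by rw [e]; group
            rw [this]
            exact A.mul_mem (A.mul_mem hk.1 hc) (A.inv_mem hk'.1)
          refine ⟨b, hb, a * z', mul_mem ha ⟨hz', hz'A⟩, k', hk', ?_⟩
          rw [mul_assoc, e]; group
        · rintro _ ⟨b, hb, a, ha, k, hk, rfl⟩ c hc
          obtain ⟨z', hz', k', hk', e⟩ := hBZ (k * c) (B.mul_mem hk.2 hc)
          have hz'B : z' ∈ B := by
            have : z' = k * c * k'⁻¹ := by rw [e]; group
            rw [this]
            exact B.mul_mem (B.mul_mem hk.2 hc) (B.inv_mem hk'.2)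
          refine ⟨b * z', mul_mem hb ⟨hz', hz'B⟩, a, ha, k', hk', ?_⟩
          calc b * a * k * c = b * a * (k * c) := by group
            _ = b * (a * z') * k' := by rw [e]; group
            _ = _ := by rw [comm_of_isCyclic ha.1 hz']; group
      intro t ht
      obtain ⟨b, hb, a, ha, k, hk, rfl⟩ := hS t ht
      exact ⟨b, hb.2, a * k, A.mul_mem ha.2 hk.1, by group⟩
    · left
      push Not at hBZ
      obtain ⟨y, hy, hyZ⟩ := hBZ
      rw [sup_comm] at hAB
      rw [inf_comm] at hT hyZ hAZ
      exact inProd_comm (inProd_of_subset hA hAB hy hyZ (hT.change (hB.le hy) hyZ) hAZ)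
  · push Not at hAZ
    obtain ⟨y, hy, hyZ⟩ := hAZ
    replace hT := hT.change (hA hy) hyZ
    by_cases hBZ : ∀ b ∈ B, InProd Z (A ⊓ B) b
    · exact Or.inl (inProd_of_subset hB.le hAB hy hyZ hT hBZ)
    · push Not at hBZ
      obtain ⟨b, hb, hbZ⟩ := hBZ
      obtain ⟨z, hz, k, hk, rfl⟩ := (hT b (hB.le hb)).resolve_left hbZ
      have hzy : z * y ∈ B := by simpa using B.mul_mem hb (B.inv_mem hk.2)
      have hzyZ : ¬ InProd Z (A ⊓ B) (z * y) := by
        rintro ⟨z', hz', k', hk', e⟩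
        exact hyZ ⟨z⁻¹ * z', mul_mem (inv_mem hz) hz', k', hk', by rw [mul_assoc, ← e]; group⟩
      have hT' := hT.change (hB.le hzy) hzyZ
      rw [inf_comm] at hT'
      refine (inProd_or_inf_le hB hA hzy hT' (inv_mem hz) (by simpa using hy)).imp id ?_
      intro h
      exact ⟨y, hy, z, hz, hyZ, hzy, hT, h⟩

/-- If `B A = T` with `A ≠ B` maximal in `T`, then `A ∩ B` is maximal in `A`. -/
lemma inf_covBy_of_inProd [Finite Γ] [IsCyclic Z] (hZ : Z ≤ T) (hA : A ≤ T) (hB : B ⋖ T)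
    (hAB : ¬ A ≤ B) (hT : TwoCosets Z (A ⊓ B) T x) (hprod : ∀ t ∈ T, InProd A B t) :
    A ⊓ B ⋖ A := by
  refine ⟨lt_of_le_of_ne inf_le_left (fun h => hAB (inf_eq_left.1 h)), ?_⟩
  intro U hU1 hU2
  have hUB : U ⊓ B = A ⊓ B :=
    le_antisymm (inf_le_inf_right _ hU2.le) (le_inf hU1.le inf_le_right)
  have hUsup : U ⊔ B = T := by
    refine (hB.eq_or_eq le_sup_right (sup_le (hU2.le.trans hA) hB.le)).resolve_left ?_
    intro h
    rw [sup_eq_right] at h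
    exact hU1.not_ge (le_inf hU2.le h)
  rcases inProd_or_exists (A := U) hB hUsup (hUB.symm ▸ hT) with h | h
  -- If also `T = U B`, then `[U : A ∩ B] = [T : B] = [A : A ∩ B]`, which forces `U = A`.
  · have e1 := relIndex_eq_of_mul (hU2.le.trans hA) (inProd_comm h)
    have e2 := relIndex_eq_of_mul hA hprod
    have e3 := Subgroup.relIndex_mul_relIndex (A ⊓ B) U A hU1.le hU2.le
    rw [← hUB, Subgroup.inf_relIndex_left, hUB, Subgroup.inf_relIndex_left, e1, e2] at e3
    have h0 : B.relIndex T ≠ 0 := Subgroup.FiniteIndex.index_ne_zero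
    have : U.relIndex A = 1 := by
      apply Nat.eq_of_mul_eq_mul_left (Nat.pos_of_ne_zero h0)
      rw [e3, mul_one]
    exact hU2.not_ge (Subgroup.relIndex_eq_one.1 this)
  · rw [hUB] at h
    obtain ⟨y, hyU, z, hz, hyZ, hzyB, hTy, hZU⟩ := h
    have hyA := hU2.le hyU
    have hyH : y ∉ A ⊓ B := fun h => hyZ ⟨1, one_mem _, y, h, by simp⟩
    -- `U = H ∪ y H`, where `H = A ∩ B`
    have hUc : ∀ u ∈ U, u ∈ A ⊓ B ∨ ∃ k ∈ A ⊓ B, u = y * k := by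
      intro u hu
      obtain ⟨w, hw, hwU, k, hk, rfl | rfl⟩ := hTy.mem_cases hU1.le hyU (hU2.le.trans hA) hu
      · exact Or.inl (mul_mem ⟨hU2.le hwU, hZU ⟨hw, hwU⟩⟩ hk)
      · have hwB : w ∈ B := hZU ⟨hw, hwU⟩
        have h1 : y⁻¹ * w * y ∈ A :=
          A.mul_mem (A.mul_mem (A.inv_mem hyA) (hU2.le hwU)) hyA
        have h2 : y⁻¹ * w * y ∈ B := by
          have := B.mul_mem (B.mul_mem (B.inv_mem hzyB) hwB) hzyB
          have e : (z * y)⁻¹ * w * (z * y) = y⁻¹ * w * y := by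
            have e1 : w * z = z * w := comm_of_isCyclic hw hz
            calc (z * y)⁻¹ * w * (z * y) = y⁻¹ * z⁻¹ * (w * z) * y := by group
              _ = _ := by rw [e1]; group
          rwa [e] at this
        exact Or.inr ⟨y⁻¹ * w * y * k, mul_mem ⟨h1, h2⟩ hk, by group⟩
    have hconj : ∀ k ∈ A ⊓ B, ∃ k' ∈ A ⊓ B, k * y = y * k' := by
      intro k hk
      refine (hUc (k * y) (mul_mem (hU1.le hk) hyU)).resolve_left fun h => hyH ?_
      simpa using mul_mem (inv_mem hk) h
    have hyy : y * y ∈ A ⊓ B := by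
      refine (hUc (y * y) (mul_mem hyU hyU)).resolve_right ?_
      rintro ⟨k, hk, e⟩
      exact hyH ((mul_left_cancel e) ▸ hk)
    have hTzy : TwoCosets Z (A ⊓ B) T (z * y) := by
      refine hTy.change (hB.le hzyB) ?_
      rintro ⟨z', hz', k', hk', e⟩
      exact hyZ ⟨z⁻¹ * z', mul_mem (inv_mem hz) hz', k', hk', by rw [mul_assoc, ← e]; group⟩
    -- The rest of the argument refutes this exceptional case through the parity of exponents of
    -- `c`, where `c` carries `z y ∈ B` to `y ∈ U`.
    obtain ⟨c, hc⟩ : ∃ c, c = z⁻¹ := ⟨_, rfl⟩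
    have hcZ : c ∈ Z := hc ▸ inv_mem hz
    have hcy : c * (z * y) = y := by rw [hc]; group
    -- left multiplication by `B` preserves `c B ∪ c⁻¹ B`
    have hstep : ∀ β ∈ B, (∃ β' ∈ B, β * c = c * β') ∨ ∃ β' ∈ B, β * c = c⁻¹ * β' := by
      intro β hβ
      obtain ⟨w, hw, hwB, k, hk, rfl | rfl⟩ := hTzy.mem_cases inf_le_right hzyB hB.le hβ
      · obtain ⟨k', hk', e⟩ := hconj k hk
        refine Or.inl ⟨w * ((z * y) * k' * (z * y)⁻¹), B.mul_mem hwB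
          (B.mul_mem (B.mul_mem hzyB hk'.2) (B.inv_mem hzyB)), ?_⟩
        have e1 : w * c = c * w := comm_of_isCyclic hw hcZ
        calc w * k * c = w * (k * y) * (z * y)⁻¹ := by rw [hc]; group
          _ = w * c * (z * y * k' * (z * y)⁻¹) := by rw [e, hc]; group
          _ = _ := by rw [e1]; group
      · obtain ⟨k', hk', e⟩ := hconj k hk
        refine Or.inr ⟨w * (y * y * k' * (z * y)⁻¹), B.mul_mem hwB
          (B.mul_mem (B.mul_mem hyy.2 hk'.2) (B.inv_mem hzyB)), ?_⟩
        have e1 : w * z = z * w := comm_of_isCyclic hw hz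
        calc w * (z * y) * k * c = w * z * y * (k * y) * (z * y)⁻¹ := by rw [hc]; group
          _ = w * z * (y * y * k' * (z * y)⁻¹) := by rw [e]; group
          _ = _ := by rw [e1, hc]; group
    have hstep' : ∀ β ∈ B, (∃ β' ∈ B, β * c⁻¹ = c * β') ∨ ∃ β' ∈ B, β * c⁻¹ = c⁻¹ * β' := by
      intro β hβ
      have e : c⁻¹ = (z * y) * c * ((z * y) * (y * y)⁻¹) := by
        rw [mul_assoc, ← mul_assoc c, hcy, hc]
        group
      have hβ' : β * (z * y) ∈ B := B.mul_mem hβ hzyB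
      have hβ'' : (z * y) * (y * y)⁻¹ ∈ B := B.mul_mem hzyB (B.inv_mem hyy.2)
      have e2 : β * c⁻¹ = (β * (z * y)) * c * ((z * y) * (y * y)⁻¹) := by
        conv_lhs => rw [e]
        group
      rcases hstep _ hβ' with ⟨γ, hγ, e'⟩ | ⟨γ, hγ, e'⟩
      · exact Or.inl ⟨_, B.mul_mem hγ hβ'', by rw [e2, e', mul_assoc]⟩
      · exact Or.inr ⟨_, B.mul_mem hγ hβ'', by rw [e2, e', mul_assoc]⟩
    -- Moving `β` past one factor `c` or `c⁻¹` changes that exponent to `±1`, so the parity of the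
    -- total exponent survives. This makes `E` below, the part of `T = ⟨c⟩ B` with even exponent, a
    -- subgroup.
    have hpow : ∀ (n : ℤ), ∀ β ∈ B, ∃ m : ℤ, Even (n - m) ∧ ∃ β' ∈ B, β * c ^ n = c ^ m * β' := by
      intro n
      induction n with
      | zero => exact fun β hβ => ⟨0, by simp, β, hβ, by simp⟩
      | succ n ih =>
        intro β hβ
        obtain ⟨m, hm, β', hβ', e⟩ := ih β hβ
        rcases hstep β' hβ' with ⟨γ, hγ, e'⟩ | ⟨γ, hγ, e'⟩
        · exact ⟨m + 1, by simpa using hm, γ, hγ, by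
            rw [zpow_add_one, ← mul_assoc, e, mul_assoc, e', zpow_add_one, mul_assoc]⟩
        · exact ⟨m - 1, by
            have : (n : ℤ) + 1 - (m - 1) = n - m + 2 := by ring
            rw [this]; exact hm.add even_two, γ, hγ, by
            rw [zpow_add_one, ← mul_assoc, e, mul_assoc, e', zpow_sub_one, mul_assoc]⟩
      | pred n ih =>
        intro β hβ
        obtain ⟨m, hm, β', hβ', e⟩ := ih β hβ
        rcases hstep' β' hβ' with ⟨γ, hγ, e'⟩ | ⟨γ, hγ, e'⟩
        · exact ⟨m + 1, by
            have : -(n : ℤ) - 1 - (m + 1) = -n - m - 2 := by ring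
            rw [this]; exact hm.sub even_two, γ, hγ, by
            rw [zpow_sub_one, ← mul_assoc, e, mul_assoc, e', zpow_add_one, mul_assoc]⟩
        · exact ⟨m - 1, by simpa using hm, γ, hγ, by
            rw [zpow_sub_one, ← mul_assoc, e, mul_assoc, e', zpow_sub_one, mul_assoc]⟩
    have hall : ∀ t ∈ T, ∃ n : ℤ, ∃ β ∈ B, t = c ^ n * β := by
      intro t ht
      rw [← hUsup] at ht
      refine mem_of_mem_sup (S := {t | ∃ n : ℤ, ∃ β ∈ B, t = c ^ n * β})
        ⟨0, 1, one_mem _, by simp⟩ ?_ ?_ ht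
      · rintro _ ⟨n, β, hβ, rfl⟩ u hu
        obtain hu | ⟨k, hk, rfl⟩ := hUc u hu
        · exact ⟨n, β * u, mul_mem hβ hu.2, by group⟩
        · obtain ⟨m, -, γ, hγ, e⟩ := hpow 1 β hβ
          refine ⟨n + m, γ * (z * y) * k, mul_mem (mul_mem hγ hzyB) hk.2, ?_⟩
          rw [zpow_one] at e
          calc c ^ n * β * (y * k) = c ^ n * (β * c) * (z * y) * k := by rw [hc]; group
            _ = _ := by rw [e, zpow_add]; group
      · rintro _ ⟨n, β, hβ, rfl⟩ b hb
        exact ⟨n, β * b, mul_mem hβ hb, by group⟩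
    let E : Subgroup Γ :=
      { carrier := {t | ∃ n : ℤ, Even n ∧ ∃ β ∈ B, t = c ^ n * β}
        one_mem' := ⟨0, by simp, 1, one_mem _, by simp⟩
        mul_mem' := by
          rintro _ _ ⟨n, hn, β, hβ, rfl⟩ ⟨m, hm, γ, hγ, rfl⟩
          obtain ⟨l, hl, δ, hδ, e⟩ := hpow m β hβ
          refine ⟨n + l, hn.add ((Int.even_sub.1 hl).1 hm), δ * γ, mul_mem hδ hγ, ?_⟩
          calc c ^ n * β * (c ^ m * γ) = c ^ n * (β * c ^ m) * γ := by group
            _ = _ := by rw [e, zpow_add]; group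
        inv_mem' := by
          rintro _ ⟨n, hn, β, hβ, rfl⟩
          obtain ⟨l, hl, δ, hδ, e⟩ := hpow (-n) β⁻¹ (inv_mem hβ)
          exact ⟨l, (Int.even_sub.1 hl).1 hn.neg, δ, hδ, by rw [← e]; group⟩ }
    have hBE : B ≤ E := fun b hb => ⟨0, by simp, b, hb, by simp⟩
    have hET : E ≤ T := by
      rintro _ ⟨n, -, β, hβ, rfl⟩
      exact T.mul_mem (zpow_mem (hZ hcZ) n) (hB.le hβ)
    let D : Subgroup Γ := (Z ⊓ A) ⊔ (Z ⊓ B)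
    -- Writing `c = a b` with `a ∈ Z ∩ A`, `b ∈ Z ∩ B` gives `a⁻¹ y = b (z y) ∈ A ∩ B`, so `y` would
    -- lie in `Z (A ∩ B)`.
    have hzD : c ∉ D := by
      intro h
      have hD : c ∈ {t | InProd (Z ⊓ A) (Z ⊓ B) t} := by
        refine mem_of_mem_sup (S := {t | InProd (Z ⊓ A) (Z ⊓ B) t})
          ⟨1, one_mem _, 1, one_mem _, by simp⟩ ?_ ?_ h
        · rintro _ ⟨a, ha, b, hb, rfl⟩ a' ha'
          refine ⟨a * a', mul_mem ha ha', b, hb, ?_⟩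
          rw [mul_assoc, comm_of_isCyclic hb.1 ha'.1]
          group
        · rintro _ ⟨a, ha, b, hb, rfl⟩ b' hb'
          exact ⟨a, ha, b * b', mul_mem hb hb', by group⟩
      obtain ⟨a, ha, b, hb, e⟩ := hD
      have e1 : b * (z * y) = a⁻¹ * y := by
        rw [e] at hcy
        rw [eq_inv_mul_iff_mul_eq, ← mul_assoc, hcy]
      exact hyZ ⟨a, ha.1, a⁻¹ * y, ⟨A.mul_mem (A.inv_mem ha.2) hyA, e1 ▸ mul_mem hb.2 hzyB⟩, by group⟩
    -- Here `T = A B` enters: decompose `z = a b` and sort `a` by its double coset. The trivial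
    -- coset would put `z` itself in `D`; the other one gives `z ^ 2 ∈ D`.
    have hc2D : c ^ 2 ∈ D := by
      obtain ⟨a, ha, b, hb, e⟩ := hprod z (hZ hz)
      obtain ⟨w, hw, hwA, k, hk, rfl | rfl⟩ := hTy.mem_cases inf_le_left hyA hA ha
      · refine (hzD ?_).elim
        have h1 : k * b ∈ Z ⊓ B := by
          refine ⟨?_, mul_mem hk.2 hb⟩
          have : k * b = w⁻¹ * z := by rw [e]; group
          rw [this]
          exact Z.mul_mem (Z.inv_mem hw) hz
        have : z ∈ D := by
          rw [e, mul_assoc]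
          exact mul_mem (Subgroup.mem_sup_left ⟨hw, hwA⟩) (Subgroup.mem_sup_right h1)
        rw [hc]
        exact D.inv_mem this
      · have e1 : z * z = w * ((z * y) * k * b) := by
          calc z * z = z * (w * y * k * b) := by rw [← e]
            _ = (z * w) * y * k * b := by group
            _ = _ := by rw [comm_of_isCyclic hz hw]; group
        have h1 : (z * y) * k * b ∈ Z ⊓ B := by
          refine ⟨?_, mul_mem (mul_mem hzyB hk.2) hb⟩
          have : (z * y) * k * b = w⁻¹ * (z * z) := by rw [e1]; group
          rw [this]
          exact Z.mul_mem (Z.inv_mem hw) (Z.mul_mem hz hz)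
        have : z * z ∈ D := by
          rw [e1]
          exact mul_mem (Subgroup.mem_sup_left ⟨hw, hwA⟩) (Subgroup.mem_sup_right h1)
        rw [hc, inv_pow, pow_two]
        exact D.inv_mem this
    have hceven : ∀ n : ℤ, Even n → c ^ n ∈ D := by
      rintro n ⟨m, rfl⟩
      rw [← two_mul, zpow_mul]
      exact zpow_mem (by exact_mod_cast hc2D) m
    -- Maximality of `B` leaves `E = B` or `E = T`. If `E = B`, an element of `Z ∩ A` outside `B`
    -- would have odd exponent and force `c ∈ D`; so `Z ∩ A ≤ B` and `A = U`. If `E = T`, then `c`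
    -- equals an even power of `c` times an element of `Z ∩ B`, and again `c ∈ D`.
    rcases hB.eq_or_eq hBE hET with h | h
    · have hc2 : ∀ n : ℤ, Even n → c ^ n ∈ B := by
        intro n hn
        rw [← h]
        exact ⟨n, hn, 1, one_mem _, by simp⟩
      have hZA : ∀ w ∈ Z, w ∈ A → w ∈ B := by
        intro w hw hwA
        obtain ⟨n, β, hβ, rfl⟩ := hall w (hZ hw)
        rcases Int.even_or_odd n with hn | hn
        · exact mul_mem (hc2 n hn) hβ
        · refine (hzD ?_).elim
          have hβZ : β ∈ Z := by
            simpa using mul_mem (inv_mem (zpow_mem hcZ n)) hw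
          have h1 : c ^ n ∈ D := by
            have := mul_mem (Subgroup.mem_sup_left ⟨hw, hwA⟩ : c ^ n * β ∈ D)
              (D.inv_mem (Subgroup.mem_sup_right ⟨hβZ, hβ⟩))
            simpa using this
          have h2 := mul_mem (D.inv_mem (hceven (n - 1) (by
            rw [Int.even_sub_one]; exact Int.not_even_iff_odd.2 hn))) h1
          rwa [← zpow_neg, ← zpow_add, show -(n - 1) + n = 1 by ring, zpow_one] at h2
      refine hU2.not_ge fun a ha => ?_
      obtain ⟨w, hw, hwA, k, hk, rfl | rfl⟩ := hTy.mem_cases inf_le_left hyA hA ha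
      · exact mul_mem (hU1.le ⟨hwA, hZA w hw hwA⟩) (hU1.le hk)
      · exact mul_mem (mul_mem (hU1.le ⟨hwA, hZA w hw hwA⟩) hyU) (hU1.le hk)
    · have : c ∈ E := h ▸ hZ hcZ
      obtain ⟨n, hn, β, hβ, e⟩ := this
      refine hzD ?_
      have hβZ : β ∈ Z := by
        have : β = (c ^ n)⁻¹ * c := eq_inv_mul_of_mul_eq e.symm
        rw [this]
        exact mul_mem (inv_mem (zpow_mem hcZ n)) hcZ
      rw [e]
      exact mul_mem (hceven n hn) (Subgroup.mem_sup_right ⟨hβZ, hβ⟩)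

end

lemma covBy_of_relIndex_eq_two {H A : Subgroup Γ} (hHA : H ≤ A) (h : H.relIndex A = 2) :
    H ⋖ A := by
  refine ⟨lt_of_le_of_ne hHA (by rintro rfl; simp at h), fun U h1 h2 => ?_⟩
  have := Subgroup.relIndex_mul_relIndex H U A h1.le h2.le
  rw [h] at this
  have h3 : H.relIndex U ≠ 1 := fun h => h1.not_ge (Subgroup.relIndex_eq_one.1 h)
  have h4 : U.relIndex A ≠ 1 := fun h => h2.not_ge (Subgroup.relIndex_eq_one.1 h)
  rcases (Nat.dvd_prime Nat.prime_two).1 (Dvd.intro _ this) with h5 | h5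
  · exact h3 h5
  · rw [h5] at this
    exact h4 (by omega)

/-- The factors from `Z ∩ A` lie in `A ∩ B`, and so do their conjugates by `x`, because conjugation
by `x` and by `z x ∈ B` agree on `Z`. Thus `A` consists of the cosets `A ∩ B` and `x (A ∩ B)` only.
-/
lemma TwoCosets.relIndex_eq_two {Z A B T : Subgroup Γ} {x : Γ} (hT : TwoCosets Z (A ⊓ B) T x)
    [IsCyclic Z] (hA : A ≤ T) (hx : x ∈ A) (hxH : ¬ InProd Z (A ⊓ B) x) (hZ : Z ⊓ A ≤ B) {z : Γ}
    (hz : z ∈ Z) (hzx : z * x ∈ B) : (A ⊓ B).relIndex A = 2 := by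
  have hxB : x ∉ A ⊓ B := fun h => hxH ⟨1, one_mem _, x, h, by simp⟩
  rw [Subgroup.relIndex, Subgroup.index_eq_two_iff_exists_notMem_and']
  refine ⟨⟨x⁻¹, A.inv_mem hx⟩, ?_, ?_⟩
  · rw [Subgroup.mem_subgroupOf]
    simpa using hxB
  · rintro ⟨b, hb⟩
    rw [or_iff_not_imp_right, Subgroup.mem_subgroupOf, Subgroup.mem_subgroupOf]
    intro hbH
    change x⁻¹ * b ∈ A ⊓ B
    obtain ⟨w, hw, hwA, k, hk, rfl | rfl⟩ := hT.mem_cases inf_le_left hx hA hb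
    · exact (hbH (mul_mem ⟨hwA, hZ ⟨hw, hwA⟩⟩ hk)).elim
    · refine ⟨A.mul_mem (A.inv_mem hx) hb, ?_⟩
      have e1 : w * z = z * w := comm_of_isCyclic hw hz
      have e2 : x⁻¹ * (w * x * k) = (z * x)⁻¹ * w * (z * x) * k := by
        calc x⁻¹ * (w * x * k) = x⁻¹ * z⁻¹ * (z * w) * x * k := by group
          _ = _ := by rw [← e1]; group
      rw [e2]
      exact B.mul_mem (B.mul_mem (B.mul_mem (B.inv_mem hzx) (hZ ⟨hw, hwA⟩)) hzx) hk.2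

/-- Two distinct maximal subgroups of `T`. -/
lemma covBy_inf_and_relIndex [Finite Γ] {Z H T A B : Subgroup Γ} {x : Γ} [IsCyclic Z] (hZ : Z ≤ T)
    (hA : A ⋖ T) (hB : B ⋖ T) (hne : A ≠ B) (hHA : H ≤ A) (hHB : H ≤ B)
    (hT : TwoCosets Z H T x) :
    A ⊓ B ⋖ A ∧ A ⊓ B ⋖ B ∧
    ((A.relIndex T = (A ⊓ B).relIndex B ∧ B.relIndex T = (A ⊓ B).relIndex A) ∨
      (A.relIndex T = B.relIndex T ∧ (A ⊓ B).relIndex A = (A ⊓ B).relIndex B)) := by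
  have hAB : ¬ A ≤ B := fun h => hne ((hA.eq_or_eq h hB.le).resolve_right hB.ne).symm
  have hBA : ¬ B ≤ A := fun h => hne ((hB.eq_or_eq h hA.le).resolve_right hA.ne)
  have hsup : A ⊔ B = T :=
    (hA.eq_or_eq le_sup_left (sup_le hA.le hB.le)).resolve_left fun h => hBA (sup_eq_left.1 h)
  replace hT : TwoCosets Z (A ⊓ B) T x := by
    intro t ht
    refine (hT t ht).imp ?_ ?_
    · rintro ⟨z, hz, k, hk, e⟩
      exact ⟨z, hz, k, ⟨hHA hk, hHB hk⟩, e⟩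
    · rintro ⟨z, hz, k, hk, e⟩
      exact ⟨z, hz, k, ⟨hHA hk, hHB hk⟩, e⟩
  have hT' : TwoCosets Z (B ⊓ A) T x := inf_comm A B ▸ hT
  have main : (∀ t ∈ T, InProd A B t) → A ⊓ B ⋖ A ∧ A ⊓ B ⋖ B ∧
      ((A.relIndex T = (A ⊓ B).relIndex B ∧ B.relIndex T = (A ⊓ B).relIndex A) ∨
      (A.relIndex T = B.relIndex T ∧ (A ⊓ B).relIndex A = (A ⊓ B).relIndex B)) := by
    intro h
    have h' := inProd_comm h
    refine ⟨inf_covBy_of_inProd hZ hA.le hB hAB hT h, ?_, Or.inl ⟨?_, ?_⟩⟩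
    · rw [inf_comm]
      exact inf_covBy_of_inProd hZ hB.le hA hBA hT' h'
    · rw [Subgroup.inf_relIndex_right, relIndex_eq_of_mul hB.le h']
    · rw [Subgroup.inf_relIndex_left, relIndex_eq_of_mul hA.le h]
  rcases inProd_or_exists hB hsup hT with h | ⟨y, hy, z, hz, hyZ, hzy, hTy, hZA⟩
  · exact main (inProd_comm h)
  rcases inProd_or_exists hA (sup_comm A B ▸ hsup) hT' with h | ⟨y', hy', z', hz', hyZ', hzy', hTy', hZB⟩
  · exact main h
  -- Neither alternative gave `T = A B`. Now `Z ∩ A = Z ∩ B`, and `T = Z A = Z B` because each of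
  -- `A`, `B` meets both double cosets; hence `[T : A] = [Z : Z ∩ A] = [Z : Z ∩ B] = [T : B]`.
  have e1 := hTy.relIndex_eq_two hA.le hy hyZ hZA hz hzy
  have e2 := hTy'.relIndex_eq_two hB.le hy' hyZ' hZB hz' hzy'
  rw [inf_comm] at e2
  refine ⟨covBy_of_relIndex_eq_two inf_le_left e1, covBy_of_relIndex_eq_two inf_le_right e2,
    Or.inr ⟨?_, e1.trans e2.symm⟩⟩
  rw [← relIndex_eq_of_inProd hZ (hTy.inProd inf_le_left hy),
    ← relIndex_eq_of_inProd hZ (hTy'.inProd inf_le_left hy'), ← Subgroup.inf_relIndex_left,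
    ← Subgroup.inf_relIndex_left Z B]
  congr 1
  exact le_antisymm (le_inf inf_le_left hZA) (le_inf inf_le_left hZB)

/-! ### Jordan–Hölder theorem for chains of subgroups -/

/-- `MaxChain H T m`: there is a maximal chain of subgroups from `H` to `T`, and `m` is the multiset
of its indices. -/
inductive MaxChain (H : Subgroup Γ) : Subgroup Γ → Multiset ℕ → Prop
  | refl : MaxChain H H 0
  | step {A T : Subgroup Γ} {m : Multiset ℕ} (hA : MaxChain H A m) (hAT : A ⋖ T) :
      MaxChain H T (A.relIndex T ::ₘ m)

lemma MaxChain.le {H T : Subgroup Γ} {m : Multiset ℕ} (h : MaxChain H T m) : H ≤ T := by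
  induction h with
  | refl => exact le_rfl
  | step _ hAT ih => exact ih.trans hAT.le

/-- Chains grow at the top, whereas a decomposition of `f` is built from the source `C`, that is,
from the smallest group. This adds a link at the bottom. -/
lemma MaxChain.cons {H A T : Subgroup Γ} {m : Multiset ℕ} (h : MaxChain A T m) (hHA : H ⋖ A) :
    MaxChain H T (H.relIndex A ::ₘ m) := by
  induction h with
  | refl => exact .step .refl hHA
  | step hA hAT ih =>
    rw [Multiset.cons_swap]
    exact .step ih hAT

lemma card_lt_card_of_lt [Finite Γ] {A T : Subgroup Γ} (h : A < T) : Nat.card A < Nat.card T :=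
  lt_of_le_of_ne (Subgroup.card_le_of_le h.le) fun e =>
    h.ne (Subgroup.eq_of_le_of_card_ge h.le e.ge)

lemma exists_maxChain [Finite Γ] {H T : Subgroup Γ} (h : H ≤ T) : ∃ m, MaxChain H T m := by
  induction hn : Nat.card T using Nat.strong_induction_on generalizing T with
  | _ n ih =>
    rcases h.eq_or_lt with rfl | h
    · exact ⟨_, .refl⟩
    · obtain ⟨A, hHA, hA⟩ := exists_le_covBy_of_lt h
      have hlt := card_lt_card_of_lt hA.lt
      obtain ⟨m, hm⟩ := ih _ (hn ▸ hlt) hHA rfl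
      exact ⟨_, .step hm hA⟩

/-- **Jordan–Hölder theorem** for the maximal chains of subgroups between `H` and `T`, if `T` is
the union of at most two double cosets of a cyclic group and `H`. -/
theorem MaxChain.unique [Finite Γ] {H T : Subgroup Γ} {m m' : Multiset ℕ} (h : MaxChain H T m)
    (h' : MaxChain H T m') (hT : ∃ (Z : Subgroup Γ) (x : Γ), IsCyclic Z ∧ Z ≤ T ∧ TwoCosets Z H T x) :
    m = m' := by
  induction hn : Nat.card T using Nat.strong_induction_on generalizing T m m' with
  | _ n ih =>
    obtain ⟨Z, x, hZ, hZT, hT⟩ := hT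
    -- The hypothesis passes to every `A` between `H` and `T`, with `Z ∩ A` as the cyclic group, so
    -- the induction applies to the maximal subgroups.
    have hcoset : ∀ {A : Subgroup Γ}, H ≤ A → A ≤ T →
        ∃ (Z : Subgroup Γ) (x : Γ), IsCyclic Z ∧ Z ≤ A ∧ TwoCosets Z H A x := by
      intro A hHA hAT
      by_cases hA : ∀ a ∈ A, InProd Z H a
      · refine ⟨Z ⊓ A, 1, Subgroup.isCyclic_of_le inf_le_left, inf_le_right, fun a ha => ?_⟩
        obtain ⟨z, hz, k, hk, rfl⟩ := hA a ha
        exact Or.inl ⟨z, ⟨hz, by simpa using A.mul_mem ha (A.inv_mem (hHA hk))⟩, k, hk, rfl⟩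
      · push Not at hA
        obtain ⟨y, hy, hyZ⟩ := hA
        refine ⟨Z ⊓ A, y, Subgroup.isCyclic_of_le inf_le_left, inf_le_right, fun a ha => ?_⟩
        obtain ⟨z, hz, hzA, k, hk, rfl | rfl⟩ :=
          (hT.change (hAT hy) hyZ).mem_cases hHA hy hAT ha
        · exact Or.inl ⟨z, ⟨hz, hzA⟩, k, hk, rfl⟩
        · exact Or.inr ⟨z, ⟨hz, hzA⟩, k, hk, rfl⟩
    cases h with
    | refl =>
      cases h' with
      | refl => rfl
      | step hA hAT => exact (hAT.lt.not_ge hA.le).elim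
    | @step A _ m hA hAT =>
      cases h' with
      | refl => exact (hAT.lt.not_ge hA.le).elim
      | @step B _ m' hB hBT =>
        have ihA : ∀ {l}, MaxChain H A l → m = l := fun hl =>
          ih _ (hn ▸ card_lt_card_of_lt hAT.lt) hA hl (hcoset hA.le hAT.le) rfl
        have ihB : ∀ {l}, MaxChain H B l → m' = l := fun hl =>
          ih _ (hn ▸ card_lt_card_of_lt hBT.lt) hB hl (hcoset hB.le hBT.le) rfl
        by_cases hne : A = B
        · subst hne
          rw [ihA hB]
        · obtain ⟨cA, cB, e⟩ := covBy_inf_and_relIndex hZT hAT hBT hne hA.le hB.le hT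
          obtain ⟨l, hl⟩ := exists_maxChain (le_inf hA.le hB.le)
          rw [ihA (.step hl cA), ihB (.step hl cB)]
          rcases e with ⟨e1, e2⟩ | ⟨e1, e2⟩
          · rw [e1, e2, Multiset.cons_swap]
          · rw [e1, e2]

end TwoOrbits

/-! ### Rational maps of curves and embeddings of function fields -/

noncomputable section

namespace JordanCurves

variable {K : Type u} [Field K]

/-- A dominant rational map `f` restricts to the morphism `Spec K(X) ⟶ Y` that is given by the
inclusion of function fields. -/
lemma RatMap.fromFunctionField_eq {C D : Curve K} (f : RatMap C D) :
    f.map.fromFunctionField =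
      Spec.map (CommRingCat.ofHom f.pullback) ≫ D.X.fromSpecStalk (genericPoint D.X) := by
  rw [RatMap.pullback, CommRingCat.ofHom_hom, Spec.map_comp, Category.assoc,
    Scheme.SpecMap_stalkSpecializes_fromSpecStalk]
  exact (Scheme.Spec_stalkClosedPointTo_fromSpecStalk _).symm

/-- The composite lives on the smaller open set `f⁻¹(dom g)`. That set still contains the generic
point of `X`, so the comparison can be made there after composing with the open immersion of `dom
g`. -/
lemma partialMap_comp_fromFunctionField {X Y Z : Scheme.{u}} [IsIntegral X] [IsIntegral Y]
    (f : X.PartialMap Y) [IsDominant f.hom] (g : Y.PartialMap Z)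
    (φ : Y.functionField ⟶ X.functionField)
    (h : f.fromFunctionField = Spec.map φ ≫ Y.fromSpecStalk (genericPoint Y)) :
    (f.comp g).fromFunctionField = Spec.map φ ≫ g.fromFunctionField := by
  have hY : genericPoint Y ∈ g.domain :=
    (genericPoint_specializes _).mem_open g.domain.2 g.dense_domain.nonempty.choose_spec
  have hfX : genericPoint X ∈ f.domain :=
    (genericPoint_specializes _).mem_open f.domain.2 f.dense_domain.nonempty.choose_spec
  have hX : genericPoint X ∈ f.domain.ι ''ᵁ f.hom ⁻¹ᵁ g.domain :=
    (genericPoint_specializes _).mem_open (f.comp g).domain.2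
      (f.comp g).dense_domain.nonempty.choose_spec
  have key : (f.domain.ι ''ᵁ f.hom ⁻¹ᵁ g.domain).fromSpecStalkOfMem (genericPoint X) hX ≫
      (f.domain.ι.isoImage (f.hom ⁻¹ᵁ g.domain)).inv ≫ f.hom ∣_ g.domain =
      Spec.map φ ≫ g.domain.fromSpecStalkOfMem (genericPoint Y) hY := by
    rw [← cancel_mono g.domain.ι]
    simp only [Category.assoc, morphismRestrict_ι, Scheme.Opens.fromSpecStalkOfMem_ι]
    rw [← h]
    change _ = f.domain.fromSpecStalkOfMem (genericPoint X) hfX ≫ f.hom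
    have : (f.domain.ι ''ᵁ f.hom ⁻¹ᵁ g.domain).fromSpecStalkOfMem (genericPoint X) hX ≫
        (f.domain.ι.isoImage (f.hom ⁻¹ᵁ g.domain)).inv ≫ (f.hom ⁻¹ᵁ g.domain).ι =
        f.domain.fromSpecStalkOfMem (genericPoint X) hfX := by
      rw [← cancel_mono f.domain.ι]
      simp only [Category.assoc, Scheme.Opens.fromSpecStalkOfMem_ι, Scheme.Hom.isoImage_inv_ι]
    rw [← this]
    simp only [Category.assoc]
  change (f.domain.ι ''ᵁ f.hom ⁻¹ᵁ g.domain).fromSpecStalkOfMem (genericPoint X) hX ≫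
      (f.domain.ι.isoImage (f.hom ⁻¹ᵁ g.domain)).inv ≫ f.hom ∣_ g.domain ≫ g.hom =
    Spec.map φ ≫ g.domain.fromSpecStalkOfMem (genericPoint Y) hY ≫ g.hom
  rw [← Category.assoc (Spec.map φ), ← key]
  simp only [Category.assoc]

lemma rationalMap_comp_fromFunctionField {X Y Z : Scheme.{u}} [IsIntegral X] [IsIntegral Y]
    [Nonempty Z] (f : X ⤏ Y) [f.IsDominant] (g : Y ⤏ Z) (φ : Y.functionField ⟶ X.functionField)
    (h : f.fromFunctionField = Spec.map φ ≫ Y.fromSpecStalk (genericPoint Y)) :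
    (f.comp g).fromFunctionField = Spec.map φ ≫ g.fromFunctionField := by
  obtain ⟨g, rfl⟩ := g.exists_rep
  have h' : f.representative.fromFunctionField =
      Spec.map φ ≫ Y.fromSpecStalk (genericPoint Y) := by
    rw [← h, ← Scheme.RationalMap.fromFunctionField_toRationalMap,
      Scheme.RationalMap.toRationalMap_representative]
  rw [Scheme.RationalMap.comp_def]
  exact partialMap_comp_fromFunctionField f.representative g _ h'

lemma fromSpecStalk_str {X : Scheme.{u}} [IsIntegral X] (str : X ⟶ Spec (CommRingCat.of K)) :
    X.fromSpecStalk (genericPoint X) ≫ str = Spec.map (CommRingCat.ofHom (constHom str)) := by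
  rw [constHom, CommRingCat.ofHom_hom, Spec.map_comp, Spec.map_comp,
    ← Scheme.fromSpecStalk_toSpecΓ, Category.assoc, Category.assoc]
  congr 1
  rw [← Scheme.toSpecΓ_naturality_assoc]
  simp

lemma RatMap.pullback_comp {C D E : Curve K} (f : RatMap C D) (g : RatMap D E) :
    (f.comp g).pullback = f.pullback.comp g.pullback := by
  have h1 := (f.comp g).fromFunctionField_eq
  have h2 := rationalMap_comp_fromFunctionField f.map g.map _ f.fromFunctionField_eq
  rw [g.fromFunctionField_eq, ← Category.assoc, ← Spec.map_comp] at h2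
  have h3 := h1.symm.trans h2
  rw [cancel_mono] at h3
  have h4 := Spec.map_injective h3
  exact congrArg CommRingCat.Hom.hom h4

lemma RatMap.pullback_const {C D : Curve K} (f : RatMap C D) (c : K) :
    f.pullback (D.const c) = C.const c := by
  have := D.locallyOfFiniteType
  have h1 : f.map.fromFunctionField ≫ D.str = C.X.fromSpecStalk _ ≫ C.str :=
    ((Scheme.RationalMap.equivFunctionField C.str D.str).symm
      ⟨f.map, Scheme.RationalMap.isOver_iff.1 f.isOver⟩).2
  rw [f.fromFunctionField_eq, Category.assoc, fromSpecStalk_str, fromSpecStalk_str,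
    ← Spec.map_comp] at h1
  exact congrArg (fun φ => φ.hom c) (Spec.map_injective h1)

lemma RatMap.ext_pullback {C D : Curve K} {f g : RatMap C D} (h : f.pullback = g.pullback) :
    f = g := by
  have : f.map = g.map := by
    apply Scheme.RationalMap.eq_of_fromFunctionField_eq
    rw [f.fromFunctionField_eq, g.fromFunctionField_eq, h]
  cases f; cases g
  congr

lemma fromSpecStalk_closedPoint {X : Scheme.{u}} {R : CommRingCat.{u}} [IsLocalRing R] (x : X)
    (φ : X.presheaf.stalk x ⟶ R) [IsLocalHom φ.hom] :
    (Spec.map φ ≫ X.fromSpecStalk x) (IsLocalRing.closedPoint R) = x := by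
  exact (congrArg (X.fromSpecStalk x) (Spec_closedPoint (f := φ))).trans
    Scheme.fromSpecStalk_closedPoint

/-- A `K`-embedding is a morphism from `Spec K(C)` to `D` over `K`, which spreads out to a rational
map because `D` is locally of finite type. It is dominant because its image contains the generic
point of `D`. -/
lemma RatMap.exists_pullback_eq {C D : Curve K} (φ : D.FunctionField →+* C.FunctionField)
    (hφ : ∀ c, φ (D.const c) = C.const c) : ∃ f : RatMap C D, f.pullback = φ := by
  have := D.locallyOfFiniteType
  have h : (Spec.map (CommRingCat.ofHom φ) ≫ D.X.fromSpecStalk (genericPoint D.X)) ≫ D.str =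
      C.X.fromSpecStalk _ ≫ C.str := by
    rw [Category.assoc, fromSpecStalk_str, fromSpecStalk_str, ← Spec.map_comp]
    congr 1
    ext c
    exact hφ c
  let f := Scheme.RationalMap.ofFunctionField C.str D.str _ h
  have hf : f.fromFunctionField = _ :=
    Scheme.RationalMap.fromFunctionField_ofFunctionField C.str D.str _ h
  have hover : f.IsOver (Spec (CommRingCat.of K)) :=
    Scheme.RationalMap.isOver_iff.2
      ((Scheme.RationalMap.equivFunctionField C.str D.str) ⟨_, h⟩).2
  have hdom : f.IsDominant := by
    obtain ⟨p, hp⟩ := f.exists_rep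
    rw [← hp] at hf ⊢
    rw [Scheme.PartialMap.isDominant_toRationalMap_iff]
    have hpt := congrArg (fun ψ : Spec C.X.functionField ⟶ D.X =>
      ψ (IsLocalRing.closedPoint C.X.functionField)) hf
    have hloc : IsLocalHom (CommRingCat.ofHom φ).hom := inferInstanceAs (IsLocalHom φ)
    have h2 : (Spec.map (CommRingCat.ofHom φ) ≫ D.X.fromSpecStalk (genericPoint D.X))
        (IsLocalRing.closedPoint C.X.functionField) = genericPoint D.X :=
      fromSpecStalk_closedPoint _ (CommRingCat.ofHom φ)
    refine ⟨?_⟩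
    rw [DenseRange, dense_iff_closure_eq, ← Set.univ_subset_iff, ← (genericPoint_spec D.X).def]
    refine closure_mono (Set.singleton_subset_iff.2 ?_)
    exact ⟨_, hpt.trans h2⟩
  let F : RatMap C D := ⟨f, hdom, hover⟩
  refine ⟨F, ?_⟩
  have h1 := F.fromFunctionField_eq
  have h3 := hf.symm.trans h1
  rw [cancel_mono] at h3
  exact (congrArg CommRingCat.Hom.hom (Spec.map_injective h3)).symm

/-- The function field of a curve is finitely generated over the field of constants. -/
lemma Curve.const_essFiniteType (C : Curve K) : C.const.EssFiniteType := by
  have := C.locallyOfFiniteType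
  obtain ⟨_, ⟨U, hU, rfl⟩, hxU, -⟩ := C.X.isBasis_affineOpens.exists_subset_of_mem_open
    (Set.mem_univ (genericPoint C.X)) isOpen_univ
  have : Nonempty U := ⟨⟨_, hxU⟩⟩
  have hfrac := functionField_isFractionRing_of_isAffineOpen C.X U hU
  have hft := C.str.finiteType_appLE (isAffineOpen_top (Spec (CommRingCat.of K))) hU
    (by simp)
  let ψ : K →+* Γ(C.X, U) := (C.str.appLE ⊤ U (by simp)).hom.comp
    (Scheme.ΓSpecIso (CommRingCat.of K)).inv.hom
  have hψ : ψ.FiniteType := hft.comp (RingHom.FiniteType.of_surjective _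
    (Scheme.ΓSpecIso (CommRingCat.of K)).symm.commRingCatIsoToRingEquiv.surjective)
  have hc : C.const = (algebraMap Γ(C.X, U) C.X.functionField).comp ψ := by
    change ((Scheme.ΓSpecIso (CommRingCat.of K)).inv ≫ C.str.appTop ≫
      C.X.presheaf.germ ⊤ (genericPoint C.X) trivial).hom =
      ((Scheme.ΓSpecIso (CommRingCat.of K)).inv ≫ C.str.appLE ⊤ U (by simp) ≫
        C.X.presheaf.germ U (genericPoint C.X) hxU).hom
    have h : C.str.appLE ⊤ U (by simp) =
        C.str.appTop ≫ C.X.presheaf.map (homOfLE (le_top : U ≤ ⊤)).op := rfl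
    rw [h, Category.assoc, C.X.presheaf.germ_res]
  rw [hc]
  algebraize [ψ, (algebraMap Γ(C.X, U) C.X.functionField).comp ψ]
  have : Algebra.EssFiniteType Γ(C.X, U) C.X.functionField :=
    Algebra.EssFiniteType.of_isLocalization _ (nonZeroDivisors Γ(C.X, U))
  exact Algebra.EssFiniteType.comp K Γ(C.X, U) C.X.functionField

lemma constHom_specMap {R : CommRingCat.{u}} [IsDomain R] (φ : CommRingCat.of K ⟶ R) (c : K) :
    constHom (Spec.map φ) c = algebraMap R (Spec R).functionField (φ.hom c) := by
  have h := fromSpecStalk_str (Spec.map φ)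
  have h' : (Spec R).fromSpecStalk (genericPoint (Spec R)) =
      Spec.map (CommRingCat.ofHom (algebraMap R (Spec R).functionField)) :=
    Spec.fromSpecStalk_eq' _ _
  rw [h', ← Spec.map_comp] at h
  exact (congrArg (fun ψ => ψ.hom c) (Spec.map_injective h)).symm

lemma exists_curve_of_isFractionRing (R : CommRingCat.{u}) [IsDomain R]
    (φ : CommRingCat.of K ⟶ R) (hφ : φ.hom.FiniteType) {E : Type u} [Field E] [Algebra K E]
    [Algebra R E] [IsFractionRing R E] (h : ∀ c, algebraMap K E c = algebraMap R E (φ.hom c))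
    (htr : Algebra.trdeg K E = 1) :
    ∃ (A : Curve K) (e : E ≃+* A.FunctionField), ∀ c, e (algebraMap K E c) = A.const c := by
  let e : E ≃ₐ[R] (Spec R).functionField := IsLocalization.algEquiv (nonZeroDivisors R) _ _
  have hconst : ∀ c, e (algebraMap K E c) = constHom (Spec.map φ) c := fun c => by
    rw [h, e.commutes, constHom_specMap]
  let A : Curve K :=
    { X := Spec R
      str := Spec.map φ
      isIntegral := inferInstance
      isSeparated := inferInstance
      locallyOfFiniteType := HasRingHomProperty.Spec_iff.2 hφ
      quasiCompact := inferInstance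
      trdeg_eq_one := by
        let : Algebra K (Spec R).functionField := (constHom (Spec.map φ)).toAlgebra
        let e' : E ≃ₐ[K] (Spec R).functionField := AlgEquiv.ofRingEquiv (f := e.toRingEquiv) hconst
        exact e'.trdeg_eq.symm.trans htr }
  exact ⟨A, e.toRingEquiv, hconst⟩

/-- A finitely generated field extension of transcendence degree `1` is the function field of a
curve. -/
lemma exists_curve {E : Type u} [Field E] [Algebra K E] [Algebra.EssFiniteType K E]
    (htr : Algebra.trdeg K E = 1) :
    ∃ (A : Curve K) (e : E ≃+* A.FunctionField), ∀ c, e (algebraMap K E c) = A.const c := by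
  -- The affine model `Spec R` is enough: a `Curve` need be neither smooth nor proper.
  let R := Algebra.EssFiniteType.subalgebra K E
  have hR : IsFractionRing R E := by
    refine IsFractionRing.of_field R E fun x => ?_
    obtain ⟨⟨r, s⟩, h⟩ := IsLocalization.surj (Algebra.EssFiniteType.submonoid K E) x
    refine ⟨r, s, ?_⟩
    have hs : algebraMap R E s ≠ 0 :=
      ((IsLocalization.map_units E s) : IsUnit (algebraMap R E s)).ne_zero
    exact (eq_div_iff hs).2 h
  let : Algebra (CommRingCat.of R) E := inferInstanceAs (Algebra R E)
  have : IsFractionRing (CommRingCat.of R) E := hR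
  exact exists_curve_of_isFractionRing (CommRingCat.of R) (CommRingCat.ofHom (algebraMap K R))
    (RingHom.finiteType_algebraMap.2 inferInstance) (fun c => rfl) htr

end JordanCurves

end

/-! ### Decompositions as chains in a Galois group -/

noncomputable section

namespace JordanCurves

variable {K : Type u} [Field K]

/-- Frees the degree from its built-in algebra instance, so that one tower of instances can serve
all the maps. -/
lemma RatMap.degree_eq {C D : Curve K} (f : RatMap C D) [Algebra D.FunctionField C.FunctionField]
    (h : algebraMap D.FunctionField C.FunctionField = f.pullback) :
    f.degree = Module.finrank D.FunctionField C.FunctionField := by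
  have : f.pullback.toAlgebra = ‹Algebra D.FunctionField C.FunctionField› :=
    Algebra.algebra_ext _ _ fun x => congrArg (· x) h.symm
  rw [RatMap.degree, this]

/-- The extension of function fields that is given by an indecomposable rational map has no
nontrivial intermediate fields. -/
lemma RatMap.IsIndecomposable.isSimpleOrder {C D : Curve K} {f : RatMap C D}
    (hf : f.IsIndecomposable) [Algebra D.FunctionField C.FunctionField]
    (h : algebraMap D.FunctionField C.FunctionField = f.pullback)
    (E : IntermediateField D.FunctionField C.FunctionField) : E = ⊥ ∨ E = ⊤ := by
  have hdeg := hf.1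
  rw [f.degree_eq h] at hdeg
  have hfin : FiniteDimensional D.FunctionField C.FunctionField :=
    Module.finite_of_finrank_pos (by omega)
  let : Algebra K D.FunctionField := D.const.toAlgebra
  let : Algebra K C.FunctionField := C.const.toAlgebra
  have hKDC : IsScalarTower K D.FunctionField C.FunctionField :=
    .of_algebraMap_eq fun c => by rw [h]; exact (f.pullback_const c).symm
  let : Algebra K E := ((algebraMap D.FunctionField E).comp D.const).toAlgebra
  have : IsScalarTower K D.FunctionField E := .of_algebraMap_eq fun c => rfl
  have : IsScalarTower K E C.FunctionField := .of_algebraMap_eq fun c =>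
    (IsScalarTower.algebraMap_apply K D.FunctionField C.FunctionField c)
  have : Algebra.EssFiniteType K D.FunctionField := D.const_essFiniteType
  have : Algebra.EssFiniteType K E := Algebra.EssFiniteType.comp K D.FunctionField E
  have htr : Algebra.trdeg K E = 1 := by
    have h1 := trdeg_add_eq K E (A := C.FunctionField)
    rw [trdeg_eq_zero (R := E), add_zero] at h1
    exact h1.trans C.trdeg_eq_one
  -- The intermediate field `E` is realized by a curve `A`, and `f` factors through `A` with degrees
  -- `[K(C) : E]` and `[E : K(D)]`. Indecomposability makes one of them 1.
  obtain ⟨A, e, he⟩ := exists_curve (K := K) (E := E) htr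
  obtain ⟨g, hg⟩ := RatMap.exists_pullback_eq (C := C) (D := A)
    ((algebraMap E C.FunctionField).comp e.symm.toRingHom) (fun c => by
      change algebraMap E C.FunctionField (e.symm (A.const c)) = _
      rw [← he, e.symm_apply_apply, ← IsScalarTower.algebraMap_apply]
      rfl)
  obtain ⟨k, hk⟩ := RatMap.exists_pullback_eq (C := A) (D := D)
    (e.toRingHom.comp (algebraMap D.FunctionField E)) (fun c => (he c))
  have hgk : f = g.comp k := by
    apply RatMap.ext_pullback
    rw [RatMap.pullback_comp, hg, hk, ← h]
    ext x
    change _ = algebraMap E C.FunctionField (e.symm (e _))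
    rw [e.symm_apply_apply]
    rfl
  have hgdeg : g.degree = Module.finrank E C.FunctionField := by
    let : Algebra A.FunctionField C.FunctionField := g.pullback.toAlgebra
    rw [g.degree_eq rfl]
    refine (Algebra.finrank_eq_of_equiv_equiv e (RingEquiv.refl _) ?_).symm
    ext x
    change g.pullback (e x) = _
    rw [hg]
    change algebraMap E C.FunctionField (e.symm (e x)) = _
    rw [e.symm_apply_apply]
    rfl
  have hkdeg : k.degree = Module.finrank D.FunctionField E := by
    let : Algebra D.FunctionField A.FunctionField := k.pullback.toAlgebra
    rw [k.degree_eq rfl]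
    refine (Algebra.finrank_eq_of_equiv_equiv (RingEquiv.refl _) e ?_).symm
    ext x
    change k.pullback x = _
    rw [hk]
  have hlt := hf.2 A g k hgk
  rw [hgdeg, hkdeg] at hlt
  by_contra hE
  push Not at hE
  refine hlt ⟨?_, ?_⟩
  · have h0 : 0 < Module.finrank E C.FunctionField := Module.finrank_pos
    have h1 : Module.finrank E C.FunctionField ≠ 1 := fun h1 =>
      hE.2 (IntermediateField.finrank_eq_one_iff_eq_top.1 h1)
    omega
  · have h0 : 0 < Module.finrank D.FunctionField E := Module.finrank_pos
    have h1 : Module.finrank D.FunctionField E ≠ 1 := fun h1 =>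
      hE.1 (IntermediateField.finrank_eq_one_iff.1 h1)
    omega

section

variable (F A C L : Type*) [Field F] [Field A] [Field C] [Field L] [Algebra F A] [Algebra F C]
  [Algebra A C] [Algebra F L] [Algebra A L] [Algebra C L] [IsScalarTower F A C]
  [IsScalarTower F A L] [IsScalarTower F C L] [IsScalarTower A C L]

/-- The Galois group of `L / A`, as a subgroup of the Galois group of `L / F`. -/
abbrev galSubgroup : Subgroup Gal(L/F) := (IsScalarTower.toAlgHom F A L).fieldRange.fixingSubgroup

lemma mem_galSubgroup (σ : Gal(L/F)) :
    σ ∈ galSubgroup F A L ↔ ∀ a, σ (algebraMap A L a) = algebraMap A L a := by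
  rw [IntermediateField.mem_fixingSubgroup_iff]
  constructor
  · exact fun h a => h _ ⟨a, rfl⟩
  · rintro h _ ⟨a, rfl⟩
    exact h a

lemma card_galSubgroup [FiniteDimensional F L] [IsGalois F L] :
    Nat.card (galSubgroup F A L) = Module.finrank A L := by
  rw [IsGalois.card_fixingSubgroup_eq_finrank]
  refine (Algebra.finrank_eq_of_equiv_equiv
    (AlgEquiv.ofInjectiveField (IsScalarTower.toAlgHom F A L)).toRingEquiv (RingEquiv.refl _) ?_).symm
  ext x
  rfl

omit [IsScalarTower F A C] in
-- By the Galois correspondence, a group strictly between the two would have a fixed field strictly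
-- between the images of `A` and `C` in `L`; its preimage in `C` is the forbidden intermediate
-- field.
lemma galSubgroup_covBy [FiniteDimensional F L] [IsGalois F L]
    (hAC : ∀ E : IntermediateField A C, E = ⊥ ∨ E = ⊤) (hdeg : 1 < Module.finrank A C) :
    galSubgroup F C L ⋖ galSubgroup F A L ∧
      (galSubgroup F C L).relIndex (galSubgroup F A L) = Module.finrank A C := by
  have hle : (IsScalarTower.toAlgHom F A L).fieldRange ≤
      (IsScalarTower.toAlgHom F C L).fieldRange := by
    rintro _ ⟨a, rfl⟩
    exact ⟨algebraMap A C a, (IsScalarTower.algebraMap_apply A C L a).symm⟩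
  have hle' : galSubgroup F C L ≤ galSubgroup F A L := IntermediateField.fixingSubgroup_le hle
  have hidx : (galSubgroup F C L).relIndex (galSubgroup F A L) = Module.finrank A C := by
    have h1 := Subgroup.relIndex_mul_relIndex ⊥ (galSubgroup F C L) (galSubgroup F A L) bot_le hle'
    have : FiniteDimensional C L := FiniteDimensional.right F C L
    rw [Subgroup.relIndex_bot_left, Subgroup.relIndex_bot_left, card_galSubgroup, card_galSubgroup,
      ← Module.finrank_mul_finrank A C L, mul_comm] at h1
    exact Nat.eq_of_mul_eq_mul_right Module.finrank_pos h1
  refine ⟨⟨lt_of_le_of_ne hle' ?_, ?_⟩, hidx⟩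
  · intro h
    rw [h, Subgroup.relIndex_self] at hidx
    omega
  · intro U h1 h2
    have hU : (IntermediateField.fixedField U).fixingSubgroup = U :=
      IntermediateField.fixingSubgroup_fixedField U
    have h3 : IntermediateField.fixedField U ≤ (IsScalarTower.toAlgHom F C L).fieldRange := by
      rw [← IsGalois.fixedField_fixingSubgroup (IsScalarTower.toAlgHom F C L).fieldRange]
      exact IntermediateField.fixedField_antitone h1.le
    have h4 : (IsScalarTower.toAlgHom F A L).fieldRange ≤ IntermediateField.fixedField U := by
      rw [← IsGalois.fixedField_fixingSubgroup (IsScalarTower.toAlgHom F A L).fieldRange]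
      exact IntermediateField.fixedField_antitone h2.le
    let E : IntermediateField A C :=
      { (IntermediateField.fixedField U).toSubfield.comap (algebraMap C L) with
        algebraMap_mem' := fun a => by
          change algebraMap C L (algebraMap A C a) ∈ IntermediateField.fixedField U
          rw [← IsScalarTower.algebraMap_apply]
          exact h4 ⟨a, rfl⟩ }
    have hE : ∀ c, c ∈ E ↔ algebraMap C L c ∈ IntermediateField.fixedField U := fun c => Iff.rfl
    rcases hAC E with h | h
    · refine h2.not_ge ?_
      rw [← hU]
      apply IntermediateField.fixingSubgroup_le
      intro x hx
      obtain ⟨c, rfl⟩ := h3 hx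
      have : c ∈ E := hx
      rw [h] at this
      obtain ⟨a, rfl⟩ := this
      exact ⟨a, IsScalarTower.algebraMap_apply A C L a⟩
    · refine h1.not_ge ?_
      rw [← hU]
      apply IntermediateField.fixingSubgroup_le
      rintro _ ⟨c, rfl⟩
      have : c ∈ E := h ▸ IntermediateField.mem_top
      exact this

end

/-- A maximal decomposition of `f : C ⤏ D` gives a maximal chain of subgroups of the Galois group of
`L / K(D)` for every finite Galois extension `L / K(D)` that contains `K(C)`. -/
theorem IsMaximalDecomposition.maxChain {C D : Curve K} {f : RatMap C D} {l : List ℕ}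
    (h : IsMaximalDecomposition f l) : ∀ (L : Type u) [Field L] [Algebra D.FunctionField L]
    [FiniteDimensional D.FunctionField L] [IsGalois D.FunctionField L]
    [Algebra D.FunctionField C.FunctionField] [Algebra C.FunctionField L]
    [IsScalarTower D.FunctionField C.FunctionField L]
    (_ : algebraMap D.FunctionField C.FunctionField = f.pullback),
    TwoOrbits.MaxChain (galSubgroup D.FunctionField C.FunctionField L) ⊤ (l : Multiset ℕ) := by
  induction h with
  | @single C D f hf' =>
    intro L _ _ _ _ _ _ _ hf
    have hdeg := hf'.1
    rw [f.degree_eq hf] at hdeg ⊢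
    have := galSubgroup_covBy D.FunctionField D.FunctionField C.FunctionField L
      (hf'.isSimpleOrder hf) hdeg
    have htop : galSubgroup D.FunctionField D.FunctionField L = ⊤ := by
      rw [eq_top_iff]
      intro σ _
      rw [mem_galSubgroup]
      exact σ.commutes
    rw [htop] at this
    rw [← this.2]
    exact .step .refl this.1
  | @cons C A D g k l hg hk ih =>
    intro L _ _ _ _ _ _ _ hf
    let : Algebra A.FunctionField C.FunctionField := g.pullback.toAlgebra
    let : Algebra D.FunctionField A.FunctionField := k.pullback.toAlgebra
    let : Algebra A.FunctionField L :=
      ((algebraMap C.FunctionField L).comp g.pullback).toAlgebra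
    have t1 : IsScalarTower D.FunctionField A.FunctionField C.FunctionField :=
      .of_algebraMap_eq fun x => by
        rw [hf, RatMap.pullback_comp]
        rfl
    have t2 : IsScalarTower A.FunctionField C.FunctionField L := .of_algebraMap_eq fun x => rfl
    have t3 : IsScalarTower D.FunctionField A.FunctionField L := .of_algebraMap_eq fun x => by
      rw [IsScalarTower.algebraMap_apply D.FunctionField C.FunctionField L,
        IsScalarTower.algebraMap_apply D.FunctionField A.FunctionField C.FunctionField]
      rfl
    have hdeg := hg.1
    rw [g.degree_eq rfl] at hdeg ⊢
    have := galSubgroup_covBy D.FunctionField A.FunctionField C.FunctionField L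
      (hg.isSimpleOrder rfl) hdeg
    rw [← Multiset.cons_coe, ← this.2]
    exact (ih L rfl).cons this.1

end JordanCurves

end

/-! ### Orders of inertia groups in towers -/

namespace Ideal

open Module
open scoped Pointwise

section

variable {R S G : Type*} [CommRing R] [CommRing S] [Algebra R S] [Group G]
  [MulSemiringAction G S] [IsGaloisGroup G R S] [Finite G]

/-- The decomposition group is an extension of the automorphism group of the residue field, whose
order is the separable degree of the residue field extension, by the inertia group. -/
theorem card_stabilizer_eq_card_inertia_mul_finSepDegree (p : Ideal R) [p.IsPrime]
    (P : Ideal S) [P.LiesOver p] [P.IsPrime]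
    [Algebra (Localization.AtPrime p) (Localization.AtPrime P)]
    [Localization.AtPrime.IsLiesOverAlgebra p P] :
    Nat.card (MulAction.stabilizer G P) =
      Nat.card (inertia G P) * Field.finSepDegree p.ResidueField P.ResidueField := by
  have heq : (algebraMap (S ⧸ P) P.ResidueField).comp (algebraMap (R ⧸ p) (S ⧸ P)) =
      (algebraMap p.ResidueField P.ResidueField).comp (algebraMap (R ⧸ p) p.ResidueField) := by
    ext
    simp [← IsScalarTower.algebraMap_apply]
  let := ((algebraMap (S ⧸ P) P.ResidueField).comp (algebraMap (R ⧸ p) (S ⧸ P))).toAlgebra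
  have : IsScalarTower (R ⧸ p) (S ⧸ P) P.ResidueField := .of_algebraMap_eq' rfl
  have : IsScalarTower (R ⧸ p) p.ResidueField P.ResidueField := .of_algebraMap_eq' heq
  have : Normal p.ResidueField P.ResidueField :=
    Ideal.IsFractionRing.normal G p P p.ResidueField P.ResidueField
  have hindex : Subgroup.index _ = _ := Nat.card_congr
    (IsFractionRing.stabilizerQuotientInertiaEquiv G p P p.ResidueField P.ResidueField).toEquiv
  rw [Field.finSepDegree, Field.Emb, Nat.card_congr (Normal.algHomEquivAut p.ResidueField
    (AlgebraicClosure P.ResidueField) P.ResidueField), ← hindex,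
    ← ((inertia G P).subgroupOf (MulAction.stabilizer G P)).card_mul_index,
    Nat.card_congr (Subgroup.subgroupOfEquivOfLe (inertia_le_stabilizer (M := G) P)).toEquiv,
    AddSubgroup.subgroupOf_inertia]

/-- With `r` primes over `p`, both `r · |stabilizer|` and `r e f` equal `|G|`, so the decomposition
group has order `e f`. -/
theorem card_inertia_mul_finSepDegree [IsDomain R] [IsDomain S] [Module.Finite R S] [Module.Flat R S]
    (p : Ideal R) [p.IsPrime] (P : Ideal S) [P.LiesOver p] [P.IsPrime]
    [Algebra (Localization.AtPrime p) (Localization.AtPrime P)]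
    [Localization.AtPrime.IsLiesOverAlgebra p P] :
    Nat.card (inertia G P) * Field.finSepDegree p.ResidueField P.ResidueField =
      P.ramificationIdx R * P.inertiaDeg R := by
  have h1 : (p.primesOver S).ncard * Nat.card (MulAction.stabilizer G P) = Nat.card G := by
    rw [← Algebra.IsInvariant.orbit_eq_primesOver R S G p P]
    simpa using Nat.card_congr (MulAction.orbitProdStabilizerEquivGroup G P)
  have h2 := ncard_primesOver_mul_ramificationIdxIn_mul_inertiaDegIn p S G
  rw [ramificationIdxIn_eq_ramificationIdx p P G, inertiaDegIn_eq_inertiaDeg p P G] at h2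
  rw [← card_stabilizer_eq_card_inertia_mul_finSepDegree]
  have h0 : (p.primesOver S).ncard ≠ 0 := by
    intro h
    rw [h, zero_mul] at h1
    exact Nat.card_pos.ne h1
  exact Nat.eq_of_mul_eq_mul_left (Nat.pos_of_ne_zero h0) (h1.trans h2.symm)

end

/-- In a tower `R → S → T`, the index of the inertia group over `S` in the inertia group over `R`
is the ramification index of `S / R` if the residue field extension of `S / R` is separable. -/
theorem card_inertia_eq_ramificationIdx_mul_card_inertia {R S T G H : Type*} [CommRing R]
    [CommRing S] [CommRing T] [IsDomain R] [IsDomain S] [IsDomain T]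
    [Algebra R S] [Algebra S T] [Algebra R T] [IsScalarTower R S T]
    [Group G] [Finite G] [MulSemiringAction G T] [IsGaloisGroup G R T]
    [Group H] [Finite H] [MulSemiringAction H T] [IsGaloisGroup H S T]
    [Module.Finite R T] [Module.Flat R T] [Module.Finite S T] [Module.Flat S T] [Module.Finite R S]
    (p : Ideal R) (q : Ideal S) (P : Ideal T) [p.IsPrime] [q.IsPrime] [P.IsPrime]
    [q.LiesOver p] [P.LiesOver q] [P.LiesOver p]
    [Algebra (Localization.AtPrime p) (Localization.AtPrime q)]
    [Localization.AtPrime.IsLiesOverAlgebra p q]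
    [Algebra.IsSeparable p.ResidueField q.ResidueField] :
    Nat.card (inertia G P) = q.ramificationIdx R * Nat.card (inertia H P) := by
  let := Localization.AtPrime.algebraOfLiesOver p P
  let := Localization.AtPrime.algebraOfLiesOver q P
  have h1 := card_inertia_mul_finSepDegree (G := G) p P
  have h2 := card_inertia_mul_finSepDegree (G := H) q P
  have : Module.Finite p.ResidueField q.ResidueField := inferInstance
  have : Module.Finite q.ResidueField P.ResidueField := inferInstance
  have h3 := Field.finSepDegree_mul_finSepDegree_of_isAlgebraic p.ResidueField q.ResidueField
    P.ResidueField
  -- Separability turns the separable degree of the lower residue extension into its full degree.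
  -- Any inseparability then sits in the upper layer and cancels between the two formulas.
  rw [Field.finSepDegree_eq_finrank_of_isSeparable p.ResidueField q.ResidueField,
    ← inertiaDeg_eq p q] at h3
  rw [← h3, ramificationIdx_tower q P, inertiaDeg_tower q P] at h1
  have h4 : 0 < q.inertiaDeg R := inertiaDeg_pos _ _
  have h5 : 0 < Field.finSepDegree q.ResidueField P.ResidueField :=
    Nat.pos_of_ne_zero (NeZero.ne _)
  apply Nat.eq_of_mul_eq_mul_right (Nat.mul_pos h4 h5)
  rw [h1]
  calc _ = q.ramificationIdx R * q.inertiaDeg R * (P.ramificationIdx S * P.inertiaDeg S) := by ring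
    _ = _ := by rw [← h2]; ring

end Ideal

/-! ### Conjugacy of homomorphisms that agree on invariants -/

section

variable {T J : Type*} [CommRing T] [Group J] [Finite J] [MulSemiringAction J T]

/-- The polynomial `∏ (X - σ x)` has invariant coefficients, so `φ` and `ψ` map it to the same
polynomial. Since `ψ x` is a root, it is one of the `φ (σ x)`. Here `σ` still depends on `x`. -/
lemma MulSemiringAction.exists_eq_smul_of_eq_on_invariants {Ω : Type*} [CommRing Ω] [IsDomain Ω]
    {φ ψ : T →+* Ω} (h : ∀ x, (∀ σ : J, σ • x = x) → φ x = ψ x) (x : T) :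
    ∃ σ : J, ψ x = φ (σ • x) := by
  cases nonempty_fintype J
  have h1 : (MulSemiringAction.charpoly J x).map φ = (MulSemiringAction.charpoly J x).map ψ := by
    ext n
    rw [Polynomial.coeff_map, Polynomial.coeff_map]
    exact h _ fun σ => MulSemiringAction.smul_coeff_charpoly x n σ
  have h2 : ((MulSemiringAction.charpoly J x).map φ).eval (ψ x) = 0 := by
    rw [h1, Polynomial.eval_map, Polynomial.eval₂_at_apply, MulSemiringAction.eval_charpoly,
      map_zero]
  rw [MulSemiringAction.charpoly_eq, Polynomial.map_prod, Polynomial.eval_prod,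
    Finset.prod_eq_zero_iff] at h2
  obtain ⟨σ, -, hσ⟩ := h2
  exact ⟨σ, by simpa [sub_eq_zero] using hσ⟩

/-- Two homomorphisms to a domain that agree on the invariants of a finite group are conjugate. -/
theorem MulSemiringAction.exists_forall_eq_smul_of_eq_on_invariants {Ω : Type*} [CommRing Ω] [IsDomain Ω]
    {φ ψ : T →+* Ω} (h : ∀ x, (∀ σ : J, σ • x = x) → φ x = ψ x) :
    ∃ σ : J, ∀ x, ψ x = φ (σ • x) := by
  by_contra! hne
  choose x hx using hne
  cases nonempty_fintype J
  let e := Fintype.equivFin J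
  -- If each `σ` fails at some `x σ`, these elements are packed as the coefficients of a single
  -- polynomial. The pointwise statement for polynomial rings supplies one `σ` valid for all of them
  -- at once.
  let p : Polynomial T := ∑ σ, Polynomial.monomial (e σ : ℕ) (x σ)
  have hp (σ : J) : p.coeff (e σ) = x σ := by
    simp only [p, Polynomial.finsetSum_coeff, Polynomial.coeff_monomial]
    rw [Finset.sum_eq_single σ (fun τ _ hτ => if_neg fun h => hτ (e.injective (Fin.ext h)))
      (by simp), if_pos rfl]
  obtain ⟨σ, hσ⟩ := MulSemiringAction.exists_eq_smul_of_eq_on_invariants (J := J)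
    (φ := Polynomial.mapRingHom φ) (ψ := Polynomial.mapRingHom ψ) (fun q hq => by
      ext n
      simp only [Polynomial.coe_mapRingHom, Polynomial.coeff_map]
      refine h _ fun σ => ?_
      rw [← Polynomial.coeff_smul, hq]) p
  apply hx σ
  have := congrArg (fun q => Polynomial.coeff q (e σ)) hσ
  simpa only [Polynomial.coe_mapRingHom, Polynomial.coeff_map, Polynomial.coeff_smul, hp] using this

end

/-! ### Wild inertia and the tame quotient -/

namespace Valuation

section

variable {L Γ₀ I : Type*} [Field L] [LinearOrderedCommGroupWithZero Γ₀] (v : Valuation L Γ₀)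
  [Group I] [MulSemiringAction I L]

/-- The wild inertia group: the automorphisms that act trivially on the value group and on the
graded pieces of the valuation. -/
def wildInertia (I : Type*) [Group I] [MulSemiringAction I L] : Subgroup I where
  carrier := {σ | ∀ x ≠ 0, v (σ • x - x) < v x}
  one_mem' x hx := by simpa [zero_lt_iff] using hx
  mul_mem' {σ τ} hσ hτ x hx := by
    have h1 : v (τ • x) = v x := v.map_eq_of_sub_lt (hτ x hx)
    have h2 := hσ (τ • x) ((smul_ne_zero_iff_ne τ).2 hx)
    rw [h1, smul_smul] at h2
    have := v.map_add_lt h2 (hτ x hx)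
    rwa [sub_add_sub_cancel] at this
  inv_mem' {σ} hσ x hx := by
    have hy : σ⁻¹ • x ≠ 0 := (smul_ne_zero_iff_ne _).2 hx
    have h1 := hσ _ hy
    have h2 := v.map_eq_of_sub_lt h1
    rw [smul_inv_smul] at h1 h2
    rwa [map_sub_swap, h2]

lemma mem_maximalIdeal_valuationSubring_iff {a : v.valuationSubring} :
    a ∈ IsLocalRing.maximalIdeal v.valuationSubring ↔ v (a : L) < 1 := by
  rw [IsLocalRing.mem_maximalIdeal, mem_nonunits_iff]
  refine ⟨fun h => lt_of_le_of_ne a.2 fun h1 => h ?_, fun h hu => ?_⟩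
  · have h0 : (a : L) ≠ 0 := by
      intro h0
      rw [h0, map_zero] at h1
      exact zero_ne_one h1
    refine IsUnit.of_mul_eq_one ⟨(a : L)⁻¹, ?_⟩ (Subtype.ext (mul_inv_cancel₀ h0))
    rw [mem_valuationSubring_iff, map_inv₀, h1, inv_one]
  · obtain ⟨b, hb⟩ := hu.exists_right_inv
    have h2 := congrArg v (congrArg Subtype.val hb)
    simp only [MulMemClass.coe_mul, OneMemClass.coe_one, map_mul, map_one] at h2
    exact (mul_lt_one_of_lt_of_le h b.2).ne h2

variable {v}

/-- The order of an element of prime order of the wild inertia group is not a unit. -/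
theorem valuation_natCast_lt_one_of_mem_wildInertia [FaithfulSMul I L] {σ : I}
    (hσ : σ ∈ v.wildInertia I) {l : ℕ} (hpow : σ ^ l = 1) (hne : σ ≠ 1) :
    v (l : L) < 1 := by
  by_contra! hv
  obtain ⟨x, hx⟩ : ∃ x : L, σ • x ≠ x := by
    by_contra! h
    exact hne (eq_of_smul_eq_smul (α := L) fun x => by rw [h, one_smul])
  -- `y` is `l x` minus the trace sum of `x`, so its own trace sum vanishes and `-l y = ∑ (σ ^ i y -
  -- y)`. Wildness makes the right side strictly smaller than `y`, which is impossible if `v l ≥ 1`.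
  let y := l * x - ∑ i ∈ Finset.range l, σ ^ i • x
  have htr : σ • ∑ i ∈ Finset.range l, σ ^ i • x = ∑ i ∈ Finset.range l, σ ^ i • x := by
    rw [Finset.smul_sum]
    have h1 := Finset.sum_range_succ (fun i => σ ^ i • x) l
    rw [Finset.sum_range_succ', hpow, pow_zero] at h1
    simpa only [smul_smul, ← pow_succ'] using add_right_cancel h1
  have hpowtr (i : ℕ) : σ ^ i • ∑ i ∈ Finset.range l, σ ^ i • x =
      ∑ i ∈ Finset.range l, σ ^ i • x := by
    induction i with
    | zero => rw [pow_zero, one_smul]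
    | succ i ih => rw [pow_succ, mul_smul, htr, ih]
  have hl0 : (l : L) ≠ 0 := fun h => by
    rw [h, map_zero] at hv
    exact absurd hv (by simp)
  have hsl (σ : I) : σ • (l : L) = l := map_natCast (MulSemiringAction.toRingHom I L σ) l
  have hy : y ≠ 0 := by
    intro hy
    have h1 : σ • y - y = l * (σ • x - x) := by
      simp only [y, smul_sub, smul_mul', htr, hsl]
      ring
    rw [hy, smul_zero, sub_zero] at h1
    rcases mul_eq_zero.1 h1.symm with h | h
    · exact hl0 h
    · exact hx (sub_eq_zero.1 h)
  have hsum : ∑ i ∈ Finset.range l, σ ^ i • y = 0 := by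
    simp only [y, smul_sub, smul_mul', hpowtr, hsl, Finset.sum_sub_distrib, ← Finset.mul_sum,
      Finset.sum_const, Finset.card_range, nsmul_eq_mul, sub_self]
  have hlt : v (∑ i ∈ Finset.range l, (σ ^ i • y - y)) < v y :=
    v.map_sum_lt ((map_ne_zero v).2 hy) fun i _ => (v.wildInertia I).pow_mem hσ i y hy
  rw [Finset.sum_sub_distrib, hsum, zero_sub, map_neg, Finset.sum_const, Finset.card_range,
    nsmul_eq_mul, map_mul] at hlt
  exact absurd hlt (not_lt_of_ge (le_mul_of_one_le_left' hv))

variable (hI : ∀ (σ : I) (x : L), v x ≤ 1 → v (σ • x - x) < 1)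
include hI

lemma map_smul_le_of_le {x y : L} (h : v x ≤ v y) (σ : I) : v (σ • x) ≤ v (σ • y) := by
  have hle (z : L) (hz : v z ≤ 1) : v (σ • z) ≤ 1 := by
    have := v.map_add_le (hI σ z hz).le hz
    rwa [sub_add_cancel] at this
  rcases eq_or_ne y 0 with rfl | hy
  · rw [map_zero, le_zero_iff, map_eq_zero] at h
    rw [h]
  · have hy' : v y ≠ 0 := (map_ne_zero v).2 hy
    have h1 := hle (x / y) (by rw [map_div₀]; exact div_le_one_of_le₀ h zero_le)
    rw [smul_div₀', map_div₀] at h1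
    have hsy : v (σ • y) ≠ 0 := (map_ne_zero v).2 ((smul_ne_zero_iff_ne σ).2 hy)
    exact (div_le_one₀ (zero_lt_iff.2 hsy)).1 h1

/-- By monotonicity, `v x ≤ v (σ x)` propagates along the powers of `σ`; since `σ` has finite order
the chain returns to `v x`. -/
lemma map_smul_of_inertia [Finite I] (σ : I) (x : L) : v (σ • x) = v x := by
  have key (σ : I) (h : v x ≤ v (σ • x)) : v (σ • x) ≤ v x := by
    have h1 (n : ℕ) : v (σ • x) ≤ v (σ ^ (n + 1) • x) := by
      induction n with
      | zero => simp
      | succ n ih =>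
        have := map_smul_le_of_le hI h (σ ^ (n + 1))
        rw [smul_smul, ← pow_succ] at this
        exact ih.trans this
    have h2 := h1 (orderOf σ - 1)
    rwa [Nat.sub_add_cancel (orderOf_pos σ), pow_orderOf_eq_one, one_smul] at h2
  refine le_antisymm ((le_total (v x) (v (σ • x))).elim (key σ) id) ?_
  have h3 : v (σ⁻¹ • x) ≤ v x := (le_total (v x) (v (σ⁻¹ • x))).elim (key σ⁻¹) id
  simpa using map_smul_le_of_le hI h3 σ

lemma wildInertia_normal [Finite I] : (v.wildInertia I).Normal := by
  refine ⟨fun τ hτ σ x hx => ?_⟩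
  have h := hτ (σ⁻¹ • x) ((smul_ne_zero_iff_ne _).2 hx)
  rw [map_smul_of_inertia hI, ← map_smul_of_inertia hI σ, smul_sub, smul_inv_smul] at h
  simpa only [mul_smul] using h

/-- The tame quotient of the inertia group is cyclic. -/
theorem exists_forall_zpow_mul_mem_wildInertia [Finite I]
    (hπ : ∃ π : L, π ≠ 0 ∧ ∀ x ≠ 0, ∃ n : ℤ, v x = v π ^ n) :
    ∃ g : I, ∀ σ : I, ∃ k : ℤ, (g ^ k)⁻¹ * σ ∈ v.wildInertia I := by
  obtain ⟨π, hπ0, hπ⟩ := hπ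
  have hvπ : v π ≠ 0 := (map_ne_zero v).2 hπ0
  have hs (σ : I) : v (σ • π / π) = 1 := by
    rw [map_div₀, map_smul_of_inertia hI, div_self hvπ]
  have hres {x y : v.valuationSubring} : IsLocalRing.residue v.valuationSubring x =
      IsLocalRing.residue v.valuationSubring y ↔ v (x - y : L) < 1 := by
    rw [← sub_eq_zero, ← _root_.map_sub, IsLocalRing.residue_eq_zero_iff]
    exact v.mem_maximalIdeal_valuationSubring_iff
  let u (σ : I) : v.valuationSubring := ⟨σ • π / π, (hs σ).le⟩
  -- The tame character `σ ↦ σ π / π` modulo the maximal ideal. It is multiplicative because inertia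
  -- fixes the residue of the unit `τ π / π`. Its image is a finite subgroup of the units of a
  -- field, hence cyclic.
  let θ : I →* IsLocalRing.ResidueField v.valuationSubring :=
    { toFun := fun σ => IsLocalRing.residue _ (u σ)
      map_one' := by
        rw [← map_one (IsLocalRing.residue _)]
        congr 1
        exact Subtype.ext (by simp [u, hπ0])
      map_mul' := fun σ τ => by
        rw [← map_mul, hres]
        have h0 : σ • π ≠ 0 := (smul_ne_zero_iff_ne σ).2 hπ0
        have : ((u (σ * τ) : L) - (u σ * u τ : v.valuationSubring)) =
            (σ • π / π) * (σ • (τ • π / π) - τ • π / π) := by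
          change (σ * τ) • π / π - (σ • π / π) * (τ • π / π) = _
          rw [smul_div₀', mul_smul]
          field_simp
        rw [this, map_mul, hs, one_mul]
        exact hI σ _ (hs τ).le }
  have hcyc : IsCyclic θ.toHomUnits.range :=
    have : Finite θ.toHomUnits.range := Set.finite_range θ.toHomUnits
    inferInstance
  obtain ⟨⟨_, g, rfl⟩, hg⟩ := hcyc
  refine ⟨g, fun σ => ?_⟩
  obtain ⟨k, hk⟩ := hg ⟨_, σ, rfl⟩
  refine ⟨k, ?_⟩
  have h1 : θ ((g ^ k)⁻¹ * σ) = 1 := by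
    have : θ.toHomUnits ((g ^ k)⁻¹ * σ) = 1 := by
      rw [_root_.map_mul, _root_.map_inv, _root_.map_zpow, inv_mul_eq_one]
      exact congrArg Subtype.val hk
    exact congrArg Units.val this
  generalize (g ^ k)⁻¹ * σ = τ at h1 ⊢
  have h2 : v (τ • π / π - 1) < 1 := by
    rw [← map_one (IsLocalRing.residue v.valuationSubring)] at h1
    exact hres.1 h1
  intro x hx
  obtain ⟨n, hn⟩ := hπ x hx
  -- The kernel of `θ` is wild: the condition is stable under products and inverses, it holds for
  -- `π` by `h2` and for units by `hI`, and every `x` is a unit times a power of `π`.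
  have hunit (a b : L) (ha : a ≠ 0) (hb : b ≠ 0) (h : v (τ • a - a) < v a)
      (h' : v (τ • b - b) < v b) : v (τ • (a * b) - a * b) < v (a * b) := by
    have e : τ • (a * b) - a * b = (τ • a) * (τ • b - b) + (τ • a - a) * b := by
      rw [smul_mul']; ring
    rw [e, map_mul v a b]
    refine v.map_add_lt ?_ ?_
    · rw [map_mul, map_smul_of_inertia hI]
      exact mul_lt_mul_of_pos_left h' (zero_lt_iff.2 ((map_ne_zero v).2 ha))
    · rw [map_mul]
      exact mul_lt_mul_of_pos_right h (zero_lt_iff.2 ((map_ne_zero v).2 hb))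
  have hinv (a : L) (ha : a ≠ 0) (h : v (τ • a - a) < v a) : v (τ • a⁻¹ - a⁻¹) < v a⁻¹ := by
    have h0 : τ • a ≠ 0 := (smul_ne_zero_iff_ne τ).2 ha
    have e : τ • a⁻¹ - a⁻¹ = - (τ • a - a) / (τ • a) / a := by
      rw [smul_inv'']; field_simp; ring
    rw [e, map_div₀, map_div₀, map_neg, map_smul_of_inertia hI, map_inv₀, ← one_div]
    have hva : 0 < v a := zero_lt_iff.2 ((map_ne_zero v).2 ha)
    exact div_lt_div_of_pos_right ((div_lt_one₀ hva).2 h) hva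
  have hπτ : v (τ • π - π) < v π := by
    have e : τ • π - π = (τ • π / π - 1) * π := by field_simp
    rw [e, map_mul]
    simpa using mul_lt_mul_of_pos_right h2 (zero_lt_iff.2 hvπ)
  have hpow (n : ℕ) : v (τ • π ^ n - π ^ n) < v (π ^ n) := by
    induction n with
    | zero => simp
    | succ n ih =>
      rw [pow_succ]
      exact hunit _ _ (pow_ne_zero _ hπ0) hπ0 ih hπτ
  have hzpow (n : ℤ) : v (τ • π ^ n - π ^ n) < v (π ^ n) := by
    obtain ⟨n, rfl | rfl⟩ := n.eq_nat_or_neg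
    · simpa using hpow n
    · rw [zpow_neg, zpow_natCast]
      exact hinv _ (pow_ne_zero _ hπ0) (hpow n)
  have hx1 : v (x / π ^ n) = 1 := by
    rw [map_div₀, map_zpow₀, hn, div_self (zpow_ne_zero _ hvπ)]
  have := hunit (x / π ^ n) (π ^ n) (div_ne_zero hx (zpow_ne_zero _ hπ0)) (zpow_ne_zero _ hπ0)
    (by rw [hx1]; exact hI τ _ hx1.le) (hzpow n)
  rwa [div_mul_cancel₀ _ (zpow_ne_zero _ hπ0)] at this

end

end Valuation

/-! ### Valuation rings of function fields are discrete -/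

section

variable {F : Type*} [Field F]

/-- A single term of largest valuation would dominate the sum, which therefore could not vanish. -/
lemma Valuation.exists_ne_of_sum_eq_zero {Γ₀ ι : Type*} [LinearOrderedCommGroupWithZero Γ₀]
    (v : Valuation F Γ₀) {s : Finset ι} {f : ι → F} (hs : ∑ i ∈ s, f i = 0)
    {i : ι} (hi : i ∈ s) (hf : f i ≠ 0) :
    ∃ j ∈ s, ∃ k ∈ s, j ≠ k ∧ f j ≠ 0 ∧ f k ≠ 0 ∧ v (f j) = v (f k) := by
  classical
  obtain ⟨j, hj, hmax⟩ := s.exists_max_image (fun i => v (f i)) ⟨i, hi⟩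
  have hj0 : v (f j) ≠ 0 := by
    have := hmax i hi
    exact ((zero_lt_iff.2 ((_root_.map_ne_zero v).2 hf)).trans_le this).ne'
  by_contra! h
  have hlt : ∀ k ∈ s.erase j, v (f k) < v (f j) := by
    intro k hk
    have hk' := Finset.mem_of_mem_erase hk
    refine lt_of_le_of_ne (hmax k hk') fun he => ?_
    exact h j hj k hk' (Finset.ne_of_mem_erase hk).symm ((_root_.map_ne_zero v).1 hj0)
      ((_root_.map_ne_zero v).1 (he ▸ hj0)) he.symm
  have h1 := v.map_sum_lt hj0 hlt
  rw [← Finset.add_sum_erase s f hj, add_eq_zero_iff_neg_eq] at hs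
  rw [← hs, Valuation.map_neg] at h1
  exact lt_irrefl _ h1

namespace ValuationSubring

variable (O : ValuationSubring F)

/-- A valuation ring whose value group is, up to bounded torsion, generated by one element, is a
discrete valuation ring. -/
lemma isDiscreteValuationRing_of_pow {t : F} (ht0 : t ≠ 0) (ht : O.valuation t < 1) {N : ℕ}
    (hN : N ≠ 0) (h : ∀ x : F, x ≠ 0 → ∃ k : ℤ, O.valuation x ^ N = O.valuation t ^ k) :
    IsDiscreteValuationRing O := by
  have hvt : 0 < O.valuation t := zero_lt_iff.2 ((_root_.map_ne_zero _).2 ht0)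
  have h' : ∀ x : O, x ≠ 0 → ∃ k : ℕ, O.valuation x ^ N = O.valuation t ^ k := by
    intro x hx
    obtain ⟨k, hk⟩ := h x (by simpa using hx)
    have hx1 : O.valuation x ^ N ≤ 1 := pow_le_one₀ zero_le (O.valuation_le_one x)
    rw [hk] at hx1
    have hk0 : 0 ≤ k := by
      by_contra! hneg
      exact absurd hx1 (not_le_of_gt (one_lt_zpow_of_neg₀ hvt ht hneg))
    lift k to ℕ using hk0
    exact ⟨k, by simpa using hk⟩
  have hPID : IsPrincipalIdealRing O := by
    refine ⟨fun J => ?_⟩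
    by_cases hJ : J = ⊥
    · rw [hJ]; infer_instance
    -- Since `v x ^ N = v t ^ ν x`, the exponent `ν` orders elements by divisibility; an element of
    -- `J` with the least exponent generates `J`.
    choose! ν hν using h'
    have hne : ∃ n, ∃ x ∈ J, x ≠ 0 ∧ ν x = n := by
      obtain ⟨x, hx, hx0⟩ := Submodule.exists_mem_ne_zero_of_ne_bot hJ
      exact ⟨_, x, hx, hx0, rfl⟩
    classical
    obtain ⟨x, hx, hx0, hxn⟩ := Nat.find_spec hne
    refine ⟨x, le_antisymm (fun y hy => ?_) ((Ideal.span_singleton_le_iff_mem _).2 hx)⟩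
    rcases eq_or_ne y 0 with rfl | hy0
    · exact Submodule.zero_mem _
    have hle : ν x ≤ ν y := hxn.le.trans (Nat.find_min' hne ⟨y, hy, hy0, rfl⟩)
    have hle' : O.valuation y ≤ O.valuation x := by
      refine le_of_pow_le_pow_left₀ hN zero_le ?_
      rw [hν x hx0, hν y hy0]
      exact pow_le_pow_of_le_one zero_le ht.le hle
    obtain ⟨a, ha⟩ := (O.valuation_le_iff _ _).1 hle'
    refine Ideal.mem_span_singleton'.2 ⟨a, Subtype.ext ha⟩
  refine { not_a_field' := ?_ }
  intro hbot
  have htO : t ∈ O := (O.valuation_le_one_iff t).1 ht.le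
  have : (⟨t, htO⟩ : O) ∈ IsLocalRing.maximalIdeal O := (O.valuation_lt_one_iff _).2 ht
  rw [hbot, Ideal.mem_bot] at this
  exact ht0 (congrArg Subtype.val this)

variable {K : Type*} [Field K] [Algebra K F]

open Polynomial in
/-- A nontrivial valuation ring of a function field in one variable that contains the constants
is a discrete valuation ring. -/
theorem isDiscreteValuationRing_of_trdeg_eq_one [Algebra.EssFiniteType K F]
    (htr : Algebra.trdeg K F = 1) (hK : ∀ c : K, algebraMap K F c ∈ O) (hO : O ≠ ⊤) :
    IsDiscreteValuationRing O := by
  have hKv (c : K) (hc : c ≠ 0) : O.valuation (algebraMap K F c) = 1 := by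
    refine le_antisymm ((O.valuation_le_one_iff _).2 (hK c)) ?_
    have h1 := (O.valuation_le_one_iff _).2 (hK c⁻¹)
    rw [map_inv₀, map_inv₀] at h1
    have h0 : 0 < O.valuation (algebraMap K F c) :=
      zero_lt_iff.2 ((_root_.map_ne_zero _).2 ((_root_.map_ne_zero _).2 hc))
    exact (inv_le_one₀ h0).1 h1
  obtain ⟨t, ht⟩ : ∃ t : F, t ≠ 0 ∧ O.valuation t < 1 := by
    by_contra! h
    refine hO (_root_.eq_top_iff.2 fun x _ => ?_)
    rcases eq_or_ne x 0 with rfl | hx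
    · exact O.zero_mem
    have h1 := h x⁻¹ (inv_ne_zero hx)
    rw [map_inv₀, one_le_inv₀ (zero_lt_iff.2 ((_root_.map_ne_zero _).2 hx))] at h1
    exact (O.valuation_le_one_iff x).1 h1
  obtain ⟨ht0, ht1⟩ := ht
  have hvt : 0 < O.valuation t := zero_lt_iff.2 ((_root_.map_ne_zero _).2 ht0)
  have hterm (p : K[X]) (i : ℕ) (hi : p.coeff i ≠ 0) :
      O.valuation (algebraMap K F (p.coeff i) * t ^ i) = O.valuation t ^ i := by
    rw [map_mul, hKv _ hi, one_mul, map_pow]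
  -- Nonzero constants have valuation 1 and `v t < 1`, so the lowest nonzero term of `p` dominates
  -- `p(t)`.
  have hpoly (p : K[X]) (hp : p ≠ 0) : ∃ k : ℕ, O.valuation (aeval t p) = O.valuation t ^ k := by
    have hlow : p.coeff p.natTrailingDegree ≠ 0 := by
      rw [← trailingCoeff, trailingCoeff_nonzero_iff_nonzero]
      exact hp
    refine ⟨p.natTrailingDegree, ?_⟩
    rw [aeval_def, eval₂_eq_sum, sum_def, ← hterm p _ hlow]
    have hmem : p.natTrailingDegree ∈ p.support := mem_support_iff.2 hlow
    rw [← Finset.add_sum_erase _ _ hmem]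
    refine Valuation.map_add_eq_of_lt_left _ ?_
    refine Valuation.map_sum_lt _ (by rw [hterm p _ hlow]; exact pow_ne_zero _ hvt.ne') ?_
    intro i hi
    have hi' := mem_support_iff.1 (Finset.mem_of_mem_erase hi)
    rw [hterm p _ hlow, hterm p _ hi']
    refine pow_lt_pow_right_of_lt_one₀ hvt ht1 (lt_of_le_of_ne ?_ (Finset.ne_of_mem_erase hi).symm)
    exact natTrailingDegree_le_of_ne_zero hi'
  have hpoly0 (p : K[X]) (hp : p ≠ 0) : aeval t p ≠ 0 := by
    obtain ⟨k, hk⟩ := hpoly p hp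
    intro h0
    rw [h0, map_zero] at hk
    exact pow_ne_zero k hvt.ne' hk.symm
  have htrans : Transcendental K t := by
    rintro ⟨p, hp, hp0⟩
    exact hpoly0 p hp hp0
  have hE (a : IntermediateField.adjoin K {t}) (ha : a ≠ 0) :
      ∃ k : ℤ, O.valuation (a : F) = O.valuation t ^ k := by
    obtain ⟨r, s, hrs⟩ := (IntermediateField.mem_adjoin_simple_iff K _).1 a.2
    have ha' : (a : F) ≠ 0 := by simpa using ha
    have hr : r ≠ 0 := by
      rintro rfl
      rw [map_zero, zero_div] at hrs
      exact ha' hrs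
    have hs : s ≠ 0 := by
      rintro rfl
      rw [map_zero, div_zero] at hrs
      exact ha' hrs
    obtain ⟨k, hk⟩ := hpoly r hr
    obtain ⟨l, hl⟩ := hpoly s hs
    refine ⟨k - l, ?_⟩
    rw [hrs, map_div₀, hk, hl, zpow_sub₀ hvt.ne', zpow_natCast, zpow_natCast]
  have halg : Algebra.IsAlgebraic (IntermediateField.adjoin K {t}) F := by
    have hind : AlgebraicIndependent K fun _ : Unit => t :=
      algebraicIndependent_unique_type_iff.2 htrans
    have hbasis := hind.isTranscendenceBasis_of_lift_trdeg_le_of_finite (by simp [htr])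
    have := hbasis.isAlgebraic_field
    rwa [Set.range_const] at this
  have hess : Algebra.EssFiniteType (IntermediateField.adjoin K {t}) F :=
    Algebra.EssFiniteType.of_comp K _ _
  have hfin : FiniteDimensional (IntermediateField.adjoin K {t}) F :=
    Algebra.finite_of_essFiniteType_of_isAlgebraic
  let n := Module.finrank (IntermediateField.adjoin K {t}) F
  -- Two terms of the minimal equation of `x` over `K(t)` have equal valuation, so `v x ^ (j - i)`
  -- is a power of `v t` with `0 < j - i ≤ n`. The factorial is a common multiple of all these
  -- exponents.
  refine O.isDiscreteValuationRing_of_pow ht0 ht1 (Nat.factorial_ne_zero n) fun x hx => ?_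
  let p := minpoly (IntermediateField.adjoin K {t}) x
  have hp0 : p ≠ 0 := minpoly.ne_zero (Algebra.IsIntegral.isIntegral x)
  have hsum : ∑ i ∈ p.support, (algebraMap _ F (p.coeff i)) * x ^ i = 0 := by
    have := minpoly.aeval (IntermediateField.adjoin K {t}) x
    rwa [aeval_def, eval₂_eq_sum, sum_def] at this
  have hne (i : ℕ) (hi : i ∈ p.support) : algebraMap _ F (p.coeff i) * x ^ i ≠ 0 :=
    mul_ne_zero ((_root_.map_ne_zero _).2 (mem_support_iff.1 hi)) (pow_ne_zero _ hx)
  have hlead : p.natDegree ∈ p.support := natDegree_mem_support_of_nonzero hp0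
  obtain ⟨i, hi, j, hj, hij, -, -, hv⟩ := O.valuation.exists_ne_of_sum_eq_zero hsum hlead
    (hne _ hlead)
  wlog hlt : i < j generalizing i j
  · exact this j hj i hi hij.symm hv.symm (lt_of_le_of_ne (not_lt.1 hlt) hij.symm)
  obtain ⟨a, ha⟩ := hE (p.coeff i) (mem_support_iff.1 hi)
  obtain ⟨b, hb⟩ := hE (p.coeff j) (mem_support_iff.1 hj)
  have hvx : O.valuation x ≠ 0 := (_root_.map_ne_zero _).2 hx
  have hpow : O.valuation x ^ (j - i) = O.valuation t ^ (a - b) := by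
    rw [map_mul, map_mul, map_pow, map_pow] at hv
    change O.valuation (p.coeff i : F) * _ = O.valuation (p.coeff j : F) * _ at hv
    rw [ha, hb] at hv
    have h1 : O.valuation x ^ j = O.valuation x ^ i * O.valuation x ^ (j - i) := by
      rw [← pow_add]; congr 1; omega
    rw [h1, mul_left_comm, mul_comm (O.valuation t ^ a)] at hv
    rw [zpow_sub₀ hvt.ne', eq_div_iff (zpow_ne_zero _ hvt.ne'), mul_comm]
    exact (mul_left_cancel₀ (pow_ne_zero _ hvx) hv).symm
  have hjn : j ≤ n := (le_natDegree_of_mem_supp _ hj).trans (minpoly.natDegree_le x)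
  obtain ⟨c, hc⟩ : j - i ∣ n.factorial := Nat.dvd_factorial (by omega) (by omega)
  refine ⟨(a - b) * c, ?_⟩
  rw [hc, pow_mul, hpow, zpow_mul, zpow_natCast]

/-- A nontrivial valuation ring of the fraction field of a Dedekind domain `S` that contains `S` is
the localization of `S` at a maximal ideal. -/
lemma exists_eq_valuationSubringAtPrime {S : Type*} [CommRing S] [IsDedekindDomain S] [Algebra S F]
    [IsFractionRing S F] (hS : ∀ s : S, algebraMap S F s ∈ O) (hO : O ≠ ⊤) :
    ∃ w : IsDedekindDomain.HeightOneSpectrum S,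
      O = IsDedekindDomain.HeightOneSpectrum.valuationSubringAtPrime F w ∧
      O = (w.valuation F).valuationSubring ∧
      ∀ s, s ∈ w.asIdeal ↔ O.valuation (algebraMap S F s) < 1 := by
  let j : S →+* O := (algebraMap S F).codRestrict O hS
  have hj (s : S) : s ∈ (IsLocalRing.maximalIdeal O).comap j ↔
      O.valuation (algebraMap S F s) < 1 := O.valuation_lt_one_iff (j s)
  have hunit (s : S) (hs : s ∉ (IsLocalRing.maximalIdeal O).comap j) :
      (algebraMap S F s)⁻¹ ∈ O := by
    rw [hj, not_lt] at hs
    rw [← O.valuation_le_one_iff, map_inv₀]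
    exact inv_le_one_of_one_le₀ hs
  have hbot : (IsLocalRing.maximalIdeal O).comap j ≠ ⊥ := by
    intro h
    refine hO (_root_.eq_top_iff.2 fun x _ => ?_)
    obtain ⟨a, s, hs, rfl⟩ := IsFractionRing.div_surjective (A := S) x
    rw [div_eq_mul_inv]
    refine O.mul_mem _ _ (hS a) (hunit s ?_)
    rw [h, Ideal.mem_bot]
    exact nonZeroDivisors.ne_zero hs
  let w : IsDedekindDomain.HeightOneSpectrum S :=
    ⟨(IsLocalRing.maximalIdeal O).comap j, inferInstance, hbot⟩
  have hw : IsDedekindDomain.HeightOneSpectrum.valuationSubringAtPrime F w = O := by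
    refine eq_of_le_of_ne_top _ ?_ hO
    rintro _ ⟨a, s, hs, rfl⟩
    exact O.mul_mem _ _ (hS a) (hunit s hs)
  refine ⟨w, hw.symm, ?_, hj⟩
  rw [← hw]
  exact IsDedekindDomain.HeightOneSpectrum.valuationSubringAtPrime_eq_valuationSubring w

end ValuationSubring

end

/-! ### Ramification index and residue fields at primes of Dedekind domains -/

noncomputable section

namespace JordanCurves

section

open IsDedekindDomain IsDedekindDomain.HeightOneSpectrum

lemma mem_unitGroup_valuationSubring_iff {M Γ₀ : Type*} [Field M]
    [LinearOrderedCommGroupWithZero Γ₀] (v : Valuation M Γ₀) (x : Mˣ) :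
    x ∈ v.valuationSubring.unitGroup ↔ v x = 1 := by
  rw [ValuationSubring.mem_unitGroup_iff]
  exact v.isEquiv_valuation_valuationSubring.symm.eq_one_iff_eq_one

variable {R S F M : Type u} [CommRing R] [CommRing S] [Field F] [Field M]
  [IsDedekindDomain R] [IsDedekindDomain S] [Algebra R F] [IsFractionRing R F]
  [Algebra S M] [IsFractionRing S M] [Algebra R S] [Algebra F M] [Algebra R M]
  [IsScalarTower R F M] [IsScalarTower R S M]

lemma valuationOfNeZero_surjective (v : HeightOneSpectrum R) :
    Function.Surjective (v.valuationOfNeZero : Fˣ →* Multiplicative ℤ) := by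
  intro z
  obtain ⟨x, hx⟩ := v.valuation_surjective F (z : WithZero (Multiplicative ℤ))
  have hx0 : x ≠ 0 := by
    rintro rfl
    rw [map_zero] at hx
    exact WithZero.zero_ne_coe hx
  refine ⟨Units.mk0 x hx0, ?_⟩
  rw [← WithZero.coe_inj, valuationOfNeZero_eq]
  exact hx

/-- The normalized valuation of `w` maps `Mˣ` onto `ℤ` with kernel the units of the valuation ring,
and maps `Fˣ` onto `e ℤ`. The index in the definition is thus `[ℤ : e ℤ]`. -/
lemma ramificationIndex_valuationSubring [Module.IsTorsionFree R S] (v : HeightOneSpectrum R) (w : HeightOneSpectrum S)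
    [w.asIdeal.LiesOver v.asIdeal] :
    ramificationIndex (algebraMap F M) (w.valuation M).valuationSubring =
      w.asIdeal.ramificationIdx R := by
  let ν : Mˣ →* Multiplicative ℤ := w.valuationOfNeZero
  let μ : Fˣ →* Multiplicative ℤ := v.valuationOfNeZero
  have hνw (x : Mˣ) : ((ν x : Multiplicative ℤ) : WithZero (Multiplicative ℤ)) =
      w.valuation M x := valuationOfNeZero_eq w x
  have hμv (x : Fˣ) : ((μ x : Multiplicative ℤ) : WithZero (Multiplicative ℤ)) =
      v.valuation F x := valuationOfNeZero_eq v x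
  have hker : (w.valuation M).valuationSubring.unitGroup = ν.ker := by
    ext x
    rw [mem_unitGroup_valuationSubring_iff, MonoidHom.mem_ker, ← hνw, ← WithZero.coe_one,
      WithZero.coe_inj]
  have hν : ν.range = ⊤ := MonoidHom.range_eq_top.2 (valuationOfNeZero_surjective w)
  have hμν (x : Fˣ) : ν (Units.map (algebraMap F M : F →* M) x) =
      μ x ^ w.asIdeal.ramificationIdx R := by
    rw [← WithZero.coe_inj, hνw, WithZero.coe_pow, hμv,
      ← Ideal.ramificationIdx'_eq_ramificationIdx v.asIdeal w.asIdeal v.ne_bot,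
      v.valuation_liesOver M w]
    rfl
  have h1 := Subgroup.index_map (Units.map (algebraMap F M : F →* M)).range ν
  rw [hν, Subgroup.index_top, mul_one] at h1
  rw [ramificationIndex, hker, ← h1]
  have h2 : (Units.map (algebraMap F M : F →* M)).range.map ν =
      AddSubgroup.toSubgroup (AddSubgroup.zmultiples (w.asIdeal.ramificationIdx R : ℤ)) := by
    ext z
    constructor
    · rintro ⟨_, ⟨x, rfl⟩, rfl⟩
      rw [hμν]
      exact ⟨(μ x).toAdd, mul_comm _ _⟩
    · rintro ⟨n, hn⟩
      obtain ⟨x, hx⟩ := valuationOfNeZero_surjective (F := F) v (Multiplicative.ofAdd n)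
      refine ⟨_, ⟨x, rfl⟩, ?_⟩
      rw [hμν]
      change μ x = _ at hx
      rw [hx]
      exact (mul_comm _ _).trans hn
  rw [h2, AddSubgroup.index_toSubgroup, Int.index_zmultiples, Int.natAbs_natCast]

lemma isSeparable_residueField (v : HeightOneSpectrum R) (w : HeightOneSpectrum S)
    [w.asIdeal.LiesOver v.asIdeal]
    [Algebra (Localization.AtPrime v.asIdeal) (Localization.AtPrime w.asIdeal)]
    [Localization.AtPrime.IsLiesOverAlgebra v.asIdeal w.asIdeal]
    (g : valuationSubringAtPrime F v →+* valuationSubringAtPrime M w) [IsLocalHom g]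
    (hg : ∀ x, (g x : M) = algebraMap F M x)
    (hsep : letI := (IsLocalRing.ResidueField.map g).toAlgebra
      Algebra.IsSeparable (IsLocalRing.ResidueField (valuationSubringAtPrime F v))
        (IsLocalRing.ResidueField (valuationSubringAtPrime M w))) :
    Algebra.IsSeparable v.asIdeal.ResidueField w.asIdeal.ResidueField := by
  let := (IsLocalRing.ResidueField.map g).toAlgebra
  let e : valuationSubringAtPrime F v ≃ₐ[R] Localization.AtPrime v.asIdeal :=
    IsLocalization.algEquiv v.asIdeal.primeCompl _ _
  let e' : valuationSubringAtPrime M w ≃ₐ[S] Localization.AtPrime w.asIdeal :=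
    IsLocalization.algEquiv w.asIdeal.primeCompl _ _
  have : Algebra.IsSeparable (IsLocalRing.ResidueField (valuationSubringAtPrime F v))
    (IsLocalRing.ResidueField (valuationSubringAtPrime M w)) := hsep
  refine Algebra.IsSeparable.of_equiv_equiv
    (A₁ := IsLocalRing.ResidueField (valuationSubringAtPrime F v))
    (B₁ := IsLocalRing.ResidueField (valuationSubringAtPrime M w))
    (IsLocalRing.ResidueField.mapEquiv e.toRingEquiv)
    (IsLocalRing.ResidueField.mapEquiv e'.toRingEquiv) ?_
  have key : (algebraMap (Localization.AtPrime v.asIdeal) (Localization.AtPrime w.asIdeal)).comp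
      e.toRingEquiv.toRingHom = e'.toRingEquiv.toRingHom.comp g := by
    refine IsLocalization.ringHom_ext v.asIdeal.primeCompl (RingHom.ext fun r => ?_)
    have h1 : g (algebraMap R _ r) = algebraMap S _ (algebraMap R S r) := by
      apply Subtype.ext
      rw [hg]
      change algebraMap F M (algebraMap R F r) = algebraMap S M (algebraMap R S r)
      rw [← IsScalarTower.algebraMap_apply, ← IsScalarTower.algebraMap_apply]
    change algebraMap (Localization.AtPrime v.asIdeal) (Localization.AtPrime w.asIdeal)
      (e (algebraMap R _ r)) = e' (g (algebraMap R _ r))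
    rw [h1, e.commutes, e'.commutes, ← IsScalarTower.algebraMap_apply,
      ← IsScalarTower.algebraMap_apply]
  ext x
  obtain ⟨b, rfl⟩ := IsLocalRing.residue_surjective x
  exact congrArg (IsLocalRing.residue _) (RingHom.congr_fun key b)

end

end JordanCurves

end

/-! ### Tame ramification and wild inertia -/

noncomputable section

/-- As `W` is normal, `[W : W ∩ K] = [K W : K]`. This number divides both `|W|` and `[I : K]`. -/
lemma Subgroup.le_of_coprime_card_index {I : Type*} [Group I] [Finite I] (W K : Subgroup I)
    [W.Normal] (h : (Nat.card W).Coprime K.index) : W ≤ K := by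
  have h1 := relIndex_inf_mul_relIndex W K (K ⊔ W)
  have h2 := relIndex_inf_mul_relIndex K W (K ⊔ W)
  rw [inf_of_le_left le_sup_left] at h1
  rw [inf_of_le_left le_sup_right, relIndex_sup_right, inf_comm, ← h1, mul_comm] at h2
  have h3 : K.relIndex W = K.relIndex (K ⊔ W) :=
    Nat.eq_of_mul_eq_mul_left (Nat.pos_of_ne_zero (W.subgroupOf K).index_ne_zero_of_finite) h2
  have h4 : K.relIndex W ∣ K.index := h3 ▸ relIndex_dvd_index_of_le le_sup_left
  exact relIndex_eq_one.1 (Nat.eq_one_of_dvd_coprimes h (relIndex_dvd_card K W) h4)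

namespace ValuationSubring

variable {F E : Type*} [Field F] [Field E]

lemma valuation_lt_one_iff_inv_notMem (O : ValuationSubring F) (x : F) :
    O.valuation x < 1 ↔ x = 0 ∨ x⁻¹ ∉ O := by
  rcases eq_or_ne x 0 with rfl | hx
  · simp
  · have h0 : 0 < O.valuation x := zero_lt_iff.2 ((map_ne_zero _).2 hx)
    rw [← O.valuation_le_one_iff, map_inv₀, inv_le_one₀ h0, not_le]
    simp [hx]

lemma valuation_comap_lt_one_iff (O : ValuationSubring E) (f : F →+* E) (x : F) :
    (O.comap f).valuation x < 1 ↔ O.valuation (f x) < 1 := by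
  rw [valuation_lt_one_iff_inv_notMem, valuation_lt_one_iff_inv_notMem, mem_comap, map_inv₀,
    map_eq_zero]

section

variable {R L : Type*} [CommRing R] [IsDedekindDomain R] [Field L] [Algebra R F]
  [IsFractionRing R F] [Algebra F L] [Algebra R L] [IsScalarTower R F L] [FiniteDimensional F L]
  [Algebra.IsSeparable F L] (A : ValuationSubring L)

omit [IsDedekindDomain R] in
lemma mem_of_isIntegral (hR : ∀ r : R, algebraMap R L r ∈ A) {x : L} (hx : IsIntegral R x) :
    x ∈ A := by
  have hxA : IsIntegral A x := by
    obtain ⟨p, hp, hp0⟩ := hx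
    let j : R →+* A := (algebraMap R L).codRestrict A hR
    refine ⟨p.map j, hp.map j, ?_⟩
    rw [Polynomial.eval₂_map]
    exact hp0
  obtain ⟨a, ha⟩ := IsIntegrallyClosed.isIntegral_iff.1 hxA
  rw [← ha]
  exact a.2

include F in
/-- A nontrivial valuation ring of a finite separable extension is the localization of the integral
closure. -/
lemma exists_heightOneSpectrum (hR : ∀ r : R, algebraMap R L r ∈ A) (hA : A ≠ ⊤) :
    letI := IsIntegralClosure.isDedekindDomain R F L (integralClosure R L)
    letI := IsIntegralClosure.isFractionRing_of_finite_extension R F L (integralClosure R L)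
    ∃ w : IsDedekindDomain.HeightOneSpectrum (integralClosure R L),
      A = IsDedekindDomain.HeightOneSpectrum.valuationSubringAtPrime L w ∧
      A = (w.valuation L).valuationSubring ∧
      ∀ s, s ∈ w.asIdeal ↔ A.valuation (algebraMap (integralClosure R L) L s) < 1 := by
  let := IsIntegralClosure.isDedekindDomain R F L (integralClosure R L)
  let := IsIntegralClosure.isFractionRing_of_finite_extension R F L (integralClosure R L)
  exact A.exists_eq_valuationSubringAtPrime (fun s => A.mem_of_isIntegral hR s.2) hA

include F in
-- Inertia is defined by its action on the integral closure. Every element of `A` is a quotient `n /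
-- d` of integral elements with `d` a unit of `A`, and the condition passes to such quotients.
lemma valuation_smul_sub_lt_one {G : Type*} [Group G] [MulSemiringAction G L] (hR : ∀ r : R, algebraMap R L r ∈ A) (hA : A ≠ ⊤) {σ : G}
    (hσ : ∀ x : L, IsIntegral R x → A.valuation (σ • x - x) < 1) (x : L)
    (hx : A.valuation x ≤ 1) : A.valuation (σ • x - x) < 1 := by
  let := IsIntegralClosure.isDedekindDomain R F L (integralClosure R L)
  let := IsIntegralClosure.isFractionRing_of_finite_extension R F L (integralClosure R L)
  obtain ⟨w, -, hw, hwA⟩ := exists_heightOneSpectrum (F := F) A hR hA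
  have hx' : w.valuation L x ≤ 1 := by
    rw [← Valuation.mem_valuationSubring_iff, ← hw]
    exact (A.valuation_le_one_iff x).1 hx
  obtain ⟨n, d, hnd⟩ := w.exists_primeCompl_mul_eq_of_integer x hx'
  have hint (s : integralClosure R L) : A.valuation (s : L) ≤ 1 := by
    have h1 : w.valuation L (algebraMap (integralClosure R L) L s) ≤ 1 := w.valuation_le_one s
    rw [← Valuation.mem_valuationSubring_iff, ← hw] at h1
    exact (A.valuation_le_one_iff _).2 h1
  have hd1 : A.valuation (d : L) = 1 :=
    le_antisymm (hint _) (not_lt.1 fun h => d.2 ((hwA _).2 h))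
  have hd0 : (d : L) ≠ 0 := by
    intro h
    rw [h, map_zero] at hd1
    exact zero_ne_one hd1
  have hdσ : A.valuation (σ • (d : L)) = 1 := by
    rw [← hd1]
    exact Valuation.map_eq_of_sub_lt _ (by rw [hd1]; exact hσ _ d.1.2)
  have hxd : x = n / d := by
    rw [eq_div_iff hd0]
    exact hnd
  have hσd0 : σ • (d : L) ≠ 0 := (smul_ne_zero_iff_ne σ).2 hd0
  have e : σ • x - x = ((σ • (n : L) - n) * d - n * (σ • (d : L) - d)) / (σ • (d : L) * d) := by
    rw [hxd, smul_div₀']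
    field_simp
    ring
  rw [e, map_div₀, map_mul, hdσ, hd1, one_mul, div_one]
  refine Valuation.map_sub_lt _ ?_ ?_
  · rw [map_mul, hd1, mul_one]
    exact hσ _ n.2
  · rw [map_mul]
    exact (mul_le_of_le_one_left' (hint n)).trans_lt (hσ _ d.1.2)

include F in
lemma exists_uniformizer (hR : ∀ r : R, algebraMap R L r ∈ A) (hA : A ≠ ⊤) :
    ∃ π : L, π ≠ 0 ∧ ∀ x ≠ 0, ∃ n : ℤ, A.valuation x = A.valuation π ^ n := by
  let := IsIntegralClosure.isDedekindDomain R F L (integralClosure R L)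
  let := IsIntegralClosure.isFractionRing_of_finite_extension R F L (integralClosure R L)
  obtain ⟨w, -, hw, -⟩ := exists_heightOneSpectrum (F := F) A hR hA
  obtain ⟨π, hπ⟩ := w.valuation_exists_uniformizer L
  have hπ0 : π ≠ 0 := by
    rintro rfl
    rw [map_zero] at hπ
    exact WithZero.exp_ne_zero hπ.symm
  refine ⟨π, hπ0, fun x hx => ?_⟩
  have hx0 : w.valuation L x ≠ 0 := (map_ne_zero _).2 hx
  refine ⟨- WithZero.log (w.valuation L x), ?_⟩
  have h1 : w.valuation L (x / π ^ (- WithZero.log (w.valuation L x))) = 1 := by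
    rw [map_div₀, map_zpow₀, hπ, ← WithZero.exp_zsmul]
    simp [WithZero.exp_log hx0, hx0]
  have h2 : A.valuation (x / π ^ (- WithZero.log (w.valuation L x))) = 1 := by
    subst hw
    exact (Valuation.isEquiv_valuation_valuationSubring _).eq_one_iff_eq_one.1 h1
  rw [map_div₀, map_zpow₀] at h2
  exact (div_eq_one_iff_eq (zpow_ne_zero _ ((map_ne_zero _).2 hπ0))).1 h2

include F in
/-- The tame quotient of the inertia group is cyclic. -/
lemma exists_forall_zpow_mul_mem_wildInertia {G : Type*} [Group G] [Finite G]
    [MulSemiringAction G L] (hR : ∀ r : R, algebraMap R L r ∈ A) (hA : A ≠ ⊤) (I : Subgroup G)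
    (hI : ∀ σ ∈ I, ∀ x : L, IsIntegral R x → A.valuation (σ • x - x) < 1) :
    ∃ g ∈ I, ∀ σ ∈ I, ∃ k : ℤ, (g ^ k)⁻¹ * σ ∈ A.valuation.wildInertia G := by
  obtain ⟨g, hg⟩ := Valuation.exists_forall_zpow_mul_mem_wildInertia (v := A.valuation) (I := I)
    (fun σ x hx => valuation_smul_sub_lt_one (F := F) A hR hA (hI σ σ.2) x hx)
    (exists_uniformizer (F := F) A hR hA)
  refine ⟨g, g.2, fun σ hσ => ?_⟩
  obtain ⟨k, hk⟩ := hg ⟨σ, hσ⟩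
  exact ⟨k, hk⟩

end

end ValuationSubring

namespace JordanCurves

open IsDedekindDomain IsDedekindDomain.HeightOneSpectrum ValuationSubring

/-- Replaces the restricted ring by an equal ring `B`, which avoids transport along equalities of
valuation rings later on. -/
lemma IsTameAt.exists_ringHom {F M : Type u} [Field F] [Field M] {φ : F →+* M}
    {P : ValuationSubring M} (h : IsTameAt φ P) {B : ValuationSubring F} (hB : P.comap φ = B) :
    ∃ (g : B →+* P) (_ : IsLocalHom g), (∀ x, (g x : M) = φ x) ∧
      letI := (IsLocalRing.ResidueField.map g).toAlgebra
      Algebra.IsSeparable (IsLocalRing.ResidueField B) (IsLocalRing.ResidueField P) := by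
  subst hB
  exact ⟨belowHom φ P, inferInstance, fun _ => rfl, h.2⟩

/-- The wild inertia group of a place of a Galois extension `L / F` acts trivially on the
subextensions that are tamely ramified at the place. -/
theorem mem_galSubgroup_of_mem_wildInertia {R F M L : Type u} [CommRing R] [IsDedekindDomain R]
    [Field F] [Field M] [Field L] [Algebra R F] [IsFractionRing R F] [Algebra F M] [Algebra F L]
    [Algebra M L] [IsScalarTower F M L] [FiniteDimensional F L] [IsGalois F L]
    (A : ValuationSubring L) (hR : ∀ r : R, algebraMap F L (algebraMap R F r) ∈ A)
    (hF : A.comap (algebraMap F L) ≠ ⊤)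
    (hchar : ∀ l : ℕ, A.valuation (l : L) < 1 → (l : F) = 0)
    (htame : IsTameAt (algebraMap F M) (A.comap (algebraMap M L)))
    {σ : Gal(L/F)} (hσ : σ ∈ A.valuation.wildInertia Gal(L/F)) : σ ∈ galSubgroup F M L := by
  let : Algebra R L := ((algebraMap F L).comp (algebraMap R F)).toAlgebra
  let : Algebra R M := ((algebraMap F M).comp (algebraMap R F)).toAlgebra
  have : IsScalarTower R F L := .of_algebraMap_eq' rfl
  have : IsScalarTower R F M := .of_algebraMap_eq' rfl
  have : IsScalarTower R M L := .of_algebraMap_eq fun r => by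
    rw [IsScalarTower.algebraMap_apply R F L, IsScalarTower.algebraMap_apply F M L]
    rfl
  have : FiniteDimensional F M := FiniteDimensional.left F M L
  have : Algebra.IsSeparable F M := Algebra.isSeparable_tower_bot_of_isSeparable F M L
  let S := integralClosure R M
  let T := integralClosure R L
  have := IsIntegralClosure.isDedekindDomain R F L T
  have := IsIntegralClosure.isFractionRing_of_finite_extension R F L T
  have := IsIntegralClosure.isDedekindDomain R F M S
  have := IsIntegralClosure.isFractionRing_of_finite_extension R F M S
  have : Module.Finite R T := IsIntegralClosure.finite R F L T
  have : Module.Finite R S := IsIntegralClosure.finite R F M S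
  have : IsScalarTower R S L := .of_algebraMap_eq fun r => by
    rw [IsScalarTower.algebraMap_apply R M L, IsScalarTower.algebraMap_apply R S M]
    rfl
  have : FaithfulSMul R M := (faithfulSMul_iff_algebraMap_injective R M).2
    ((algebraMap F M).injective.comp (IsFractionRing.injective R F))
  have : FaithfulSMul R L := (faithfulSMul_iff_algebraMap_injective R L).2
    ((algebraMap F L).injective.comp (IsFractionRing.injective R F))
  have : Module.IsTorsionFree R S := inferInstance
  have : Module.IsTorsionFree R T := inferInstance
  let : Algebra S T := (IsIntegralClosure.lift R T L (S := S)).toAlgebra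
  have : IsScalarTower S T L := .of_algebraMap_eq fun s =>
    (IsIntegralClosure.algebraMap_lift R T L s).symm
  have : FaithfulSMul S T := (faithfulSMul_iff_algebraMap_injective S T).2 <| by
    refine Function.Injective.of_comp (f := algebraMap T L) ?_
    rw [← RingHom.coe_comp, ← IsScalarTower.algebraMap_eq, IsScalarTower.algebraMap_eq S M L]
    exact (algebraMap M L).injective.comp (IsFractionRing.injective S M)
  have : Module.IsTorsionFree S T :=
    Module.isTorsionFree_iff_algebraMap_injective.2 (FaithfulSMul.algebraMap_injective S T)
  have : Module.Flat S T := inferInstance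
  have : IsScalarTower R S T := .of_algebraMap_eq' (IsIntegralClosure.lift R T L).comp_algebraMap.symm
  have : Module.Finite S T := Module.Finite.of_restrictScalars_finite R S T
  let := IsIntegralClosure.MulSemiringAction R F L T
  have : IsGaloisGroup Gal(L/F) R T := .of_isFractionRing _ _ _ F L
  let H := fixingSubgroup Gal(L/F) (Set.range (algebraMap M L))
  have : IsGaloisGroup H M L := .of_isScalarTower Gal(L/F) F L M
  have : IsGaloisGroup H S T := .of_isFractionRing _ _ _ M L
  have hA : A ≠ ⊤ := by
    rintro rfl
    exact hF (by ext; simp)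
  have hP : A.comap (algebraMap M L) ≠ ⊤ := by
    intro h
    apply hF
    rw [IsScalarTower.algebraMap_eq F M L, ← ValuationSubring.comap_comap, h]
    ext; simp
  obtain ⟨v, hv, -, hvA⟩ := (A.comap (algebraMap F L)).exists_eq_valuationSubringAtPrime (S := R)
    hR hF
  obtain ⟨w, hw, hw', hwA⟩ := exists_heightOneSpectrum (F := F) (R := R) (A.comap (algebraMap M L))
    (fun r => by
      rw [mem_comap, ← IsScalarTower.algebraMap_apply, IsScalarTower.algebraMap_apply R F L]
      exact hR r) hP
  obtain ⟨u, -, -, huA⟩ := exists_heightOneSpectrum (F := F) (R := R) A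
    (fun r => by
      rw [IsScalarTower.algebraMap_apply R F L]
      exact hR r) hA
  simp only [valuation_comap_lt_one_iff] at hvA hwA
  have : u.asIdeal.LiesOver w.asIdeal := ⟨by
    ext s
    rw [hwA, Ideal.mem_comap, huA, ← IsScalarTower.algebraMap_apply,
      ← IsScalarTower.algebraMap_apply]⟩
  have : u.asIdeal.LiesOver v.asIdeal := ⟨by
    ext s
    rw [hvA, Ideal.mem_comap, huA, ← IsScalarTower.algebraMap_apply,
      ← IsScalarTower.algebraMap_apply]⟩
  have : w.asIdeal.LiesOver v.asIdeal := Ideal.LiesOver.tower_bot u.asIdeal w.asIdeal v.asIdeal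
  let := Localization.AtPrime.algebraOfLiesOver v.asIdeal w.asIdeal
  obtain ⟨g, hgl, hg, hsep⟩ := htame.exists_ringHom (B := A.comap (algebraMap F L)) (by
    rw [ValuationSubring.comap_comap, ← IsScalarTower.algebraMap_eq])
  have hsep' : Algebra.IsSeparable v.asIdeal.ResidueField w.asIdeal.ResidueField := by
    generalize A.comap (algebraMap F L) = B at *
    generalize A.comap (algebraMap M L) = P at *
    subst hv hw
    exact isSeparable_residueField v w g hg hsep
  have he := htame.1
  rw [hw', ramificationIndex_valuationSubring v w] at he
  have hcard := Ideal.card_inertia_eq_ramificationIdx_mul_card_inertia (G := Gal(L/F)) (H := H)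
    v.asIdeal w.asIdeal u.asIdeal
  have hsmul (τ : Gal(L/F)) (t : T) : ((τ • t : T) : L) = τ • (t : L) :=
    algebraMap.coe_smul' τ t L
  let I := u.asIdeal.inertia Gal(L/F)
  have hmemI (τ : Gal(L/F)) : τ ∈ I ↔ ∀ x : L, IsIntegral R x → A.valuation (τ • x - x) < 1 := by
    refine ⟨fun h x hx => ?_, fun h t => ?_⟩
    · have h1 := (huA _).1 (h ⟨x, hx⟩)
      rw [map_sub] at h1
      change A.valuation (((τ • (⟨x, hx⟩ : T) : T) : L) - x) < 1 at h1
      rwa [hsmul] at h1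
    · change τ • t - t ∈ u.asIdeal
      rw [huA, map_sub]
      change A.valuation (((τ • t : T) : L) - t) < 1
      rw [hsmul]
      exact h _ t.2
  have hcardK : Nat.card (H.subgroupOf I) = Nat.card (u.asIdeal.inertia H) := by
    have h1 : I.subgroupOf H = u.asIdeal.inertia H := AddSubgroup.subgroupOf_inertia _ _
    rw [← h1, ← Subgroup.inf_subgroupOf_right H I, ← Subgroup.inf_subgroupOf_left I H,
      Nat.card_congr (Subgroup.subgroupOfEquivOfLe inf_le_right).toEquiv,
      Nat.card_congr (Subgroup.subgroupOfEquivOfLe inf_le_left).toEquiv]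
  -- The tower formula for inertia groups gives `[I : I ∩ H] = e`, the ramification index of `w`
  -- over `v`.
  have hindex : (H.subgroupOf I).index = w.asIdeal.ramificationIdx R := by
    have h1 := (H.subgroupOf I).card_mul_index
    change _ = Nat.card (u.asIdeal.inertia Gal(L/F)) at h1
    rw [hcard, ← hcardK, mul_comm] at h1
    exact Nat.eq_of_mul_eq_mul_right Nat.card_pos h1
  have hI (τ : I) (x : L) (hx : A.valuation x ≤ 1) : A.valuation (τ • x - x) < 1 :=
    valuation_smul_sub_lt_one (F := F) (R := R) A
      (fun r => by
        rw [IsScalarTower.algebraMap_apply R F L]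
        exact hR r) hA ((hmemI τ).1 τ.2) x hx
  have hnormal : (A.valuation.wildInertia I).Normal := Valuation.wildInertia_normal hI
  -- A prime `l` dividing the order of wild inertia satisfies `v l < 1`, hence `l = 0` in `F`.
  -- Tameness says that `e ≠ 0` in `F`, so this order is coprime to `e` and the normal subgroup of
  -- wild elements lies in `H`.
  have hle : A.valuation.wildInertia I ≤ H.subgroupOf I := by
    refine Subgroup.le_of_coprime_card_index _ _ ?_
    rw [hindex]
    refine Nat.Coprime.symm (Nat.coprime_of_dvd fun l hl hle hlW => he ?_)
    have : Fact l.Prime := ⟨hl⟩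
    obtain ⟨τ, hτ⟩ := exists_prime_orderOf_dvd_card' l hlW
    have hτ' : orderOf (τ : I) = l := by rw [Subgroup.orderOf_coe, hτ]
    have h1 := Valuation.valuation_natCast_lt_one_of_mem_wildInertia τ.2 (l := l)
      (by rw [← hτ', pow_orderOf_eq_one]) (by
        intro h
        rw [h, orderOf_one] at hτ'
        exact hl.one_lt.ne hτ')
    obtain ⟨c, hc⟩ := hle
    rw [hc, Nat.cast_mul, hchar l h1, zero_mul]
  have hσI : σ ∈ I := by
    rw [hmemI]
    intro x hx
    rcases eq_or_ne x 0 with rfl | hx0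
    · simp
    · refine (hσ x hx0).trans_le ?_
      exact (A.valuation_le_one_iff x).2 (A.mem_of_isIntegral (R := R)
        (fun r => by
          rw [IsScalarTower.algebraMap_apply R F L]
          exact hR r) hx)
  have hσH : σ ∈ H := hle (x := ⟨σ, hσI⟩) hσ
  rw [mem_galSubgroup]
  exact fun a => hσH ⟨_, a, rfl⟩

end JordanCurves

end

/-! ### Extension of geometric places -/

noncomputable section

namespace ValuationSubring

variable {F L Ω : Type*} [Field F] [Field L] [Field Ω] [Algebra F L]

lemma valuation_comap_lt_iff {E : Type*} [Field E] (O : ValuationSubring E) (f : F →+* E)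
    (x y : F) :
    (O.comap f).valuation x < (O.comap f).valuation y ↔ O.valuation (f x) < O.valuation (f y) := by
  rcases eq_or_ne y 0 with rfl | hy
  · simp
  · have h1 : 0 < (O.comap f).valuation y := zero_lt_iff.2 ((map_ne_zero _).2 hy)
    have h2 : 0 < O.valuation (f y) := zero_lt_iff.2 ((map_ne_zero _).2 ((map_ne_zero _).2 hy))
    rw [← div_lt_one₀ h1, ← div_lt_one₀ h2, ← map_div₀, ← map_div₀, ← map_div₀,
      valuation_comap_lt_one_iff]

/-- A place of `F` with values in an algebraically closed field extends to finite separable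
extensions of `F`. -/
lemma exists_extension_of_place [IsAlgClosed Ω] [FiniteDimensional F L] [Algebra.IsSeparable F L]
    (O : ValuationSubring F) [IsDedekindDomain O] (hO : O ≠ ⊤) (e : O →+* Ω) [IsLocalHom e] :
    ∃ (A : ValuationSubring L) (φ : A →+* Ω), IsLocalHom φ ∧ A.comap (algebraMap F L) = O ∧
      ∀ (x : F) (hx : x ∈ O) (hx' : algebraMap F L x ∈ A), φ ⟨_, hx'⟩ = e ⟨x, hx⟩ := by
  let : Algebra O L := ((algebraMap F L).comp (algebraMap O F)).toAlgebra
  have : IsScalarTower O F L := .of_algebraMap_eq' rfl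
  obtain ⟨A, hmem, hloc⟩ := IsLocalRing.exists_factor_valuationRing (algebraMap O L)
  -- `A` is only known to dominate `O`. If `x ∈ A ∩ F` were not in `O`, then `x⁻¹ ∈ O` would become
  -- a unit in `A`, hence be a unit in `O` by locality.
  have hOA : A.comap (algebraMap F L) = O := by
    refine le_antisymm (fun x hx => ?_) (fun x hx => hmem ⟨x, hx⟩)
    by_contra hxO
    have hx0 : x ≠ 0 := fun h => hxO (h ▸ O.zero_mem)
    have hxi : x⁻¹ ∈ O := (O.mem_or_inv_mem x).resolve_left hxO
    have hu : IsUnit ((algebraMap O L).codRestrict A.toSubring hmem ⟨x⁻¹, hxi⟩) := by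
      refine IsUnit.of_mul_eq_one ⟨algebraMap F L x, hx⟩ (Subtype.ext ?_)
      change algebraMap F L x⁻¹ * algebraMap F L x = 1
      rw [← map_mul, inv_mul_cancel₀ hx0, map_one]
    obtain ⟨y, hy⟩ := (hloc.map_nonunit _ hu).exists_right_inv
    have hy' : x⁻¹ * (y : F) = 1 := congrArg Subtype.val hy
    apply hxO
    rw [show x = y by rw [← mul_right_inj' (inv_ne_zero hx0), hy', inv_mul_cancel₀ hx0]]
    exact y.2
  have hA : A ≠ ⊤ := by
    rintro rfl
    apply hO
    rw [← hOA]
    ext; simp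
  let j : O →+* A := (algebraMap O L).codRestrict A.toSubring hmem
  have : IsLocalHom j := hloc
  let : Algebra (IsLocalRing.ResidueField O) (IsLocalRing.ResidueField A) :=
    (IsLocalRing.ResidueField.map j).toAlgebra
  let : Algebra (IsLocalRing.ResidueField O) Ω := (IsLocalRing.ResidueField.lift e).toAlgebra
  have hres (s : A) (hs : IsIntegral O (s : L)) :
      IsAlgebraic (IsLocalRing.ResidueField O) (IsLocalRing.residue A s) := by
    obtain ⟨p, hp, hp0⟩ := hs
    refine IsIntegral.isAlgebraic ⟨p.map (IsLocalRing.residue O), hp.map _, ?_⟩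
    rw [Polynomial.eval₂_map]
    have h1 : (algebraMap (IsLocalRing.ResidueField O) (IsLocalRing.ResidueField A)).comp
        (IsLocalRing.residue O) = (IsLocalRing.residue A).comp j := rfl
    have h2 : p.eval₂ j s = 0 := Subtype.ext <| by
      change A.subtype (p.eval₂ j s) = 0
      rw [Polynomial.hom_eval₂]
      exact hp0
    rw [h1, ← Polynomial.hom_eval₂, h2, map_zero]
  -- Elements of `A` are quotients of integral elements with unit denominator, so their residues are
  -- algebraic over the residue field of `O`. The residue map can then be extended into the
  -- algebraically closed field `Ω`.
  have halg : Algebra.IsAlgebraic (IsLocalRing.ResidueField O) (IsLocalRing.ResidueField A) := by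
    refine ⟨fun x => ?_⟩
    obtain ⟨x, rfl⟩ := IsLocalRing.residue_surjective x
    let := IsIntegralClosure.isDedekindDomain O F L (integralClosure O L)
    let := IsIntegralClosure.isFractionRing_of_finite_extension O F L (integralClosure O L)
    obtain ⟨w, -, hw, hwA⟩ := exists_heightOneSpectrum (F := F) A hmem hA
    have hx' : w.valuation L x ≤ 1 := by
      rw [← Valuation.mem_valuationSubring_iff, ← hw]
      exact x.2
    obtain ⟨n, d, hnd⟩ := w.exists_primeCompl_mul_eq_of_integer (x : L) hx'
    let n' : A := ⟨n, A.mem_of_isIntegral hmem n.2⟩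
    let d' : A := ⟨d, A.mem_of_isIntegral hmem d.1.2⟩
    have hnd' : x * d' = n' := Subtype.ext hnd
    have hd0 : IsLocalRing.residue A d' ≠ 0 := by
      rw [Ne, IsLocalRing.residue_eq_zero_iff, A.valuation_lt_one_iff]
      exact fun h => d.2 ((hwA _).2 h)
    have hx : IsLocalRing.residue A x = IsLocalRing.residue A n' / IsLocalRing.residue A d' :=
      eq_div_of_mul_eq hd0 (by rw [← map_mul, hnd'])
    rw [hx]
    exact mem_algebraicClosure_iff.1 (div_mem (mem_algebraicClosure_iff.2 (hres n' n.2))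
      (mem_algebraicClosure_iff.2 (hres d' d.1.2)))
  let ψ : IsLocalRing.ResidueField A →ₐ[IsLocalRing.ResidueField O] Ω := IsAlgClosed.lift
  refine ⟨A, ψ.toRingHom.comp (IsLocalRing.residue A), inferInstance, hOA, fun x hx hx' => ?_⟩
  exact ψ.commutes (IsLocalRing.residue O ⟨x, hx⟩)

end ValuationSubring

namespace JordanCurves

variable {K : Type u} [Field K]

/-- Both function fields have transcendence degree 1 over `K`, so the extension is algebraic; being
finitely generated, it is finite. -/
lemma RatMap.finiteDimensional {C D : Curve K} (f : RatMap C D) :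
    letI := f.pullback.toAlgebra
    FiniteDimensional D.FunctionField C.FunctionField := by
  let : Algebra D.FunctionField C.FunctionField := f.pullback.toAlgebra
  let : Algebra K D.FunctionField := D.const.toAlgebra
  let : Algebra K C.FunctionField := C.const.toAlgebra
  have hKDC : IsScalarTower K D.FunctionField C.FunctionField :=
    .of_algebraMap_eq fun c => (f.pullback_const c).symm
  have : Algebra.EssFiniteType K C.FunctionField := C.const_essFiniteType
  have : Algebra.EssFiniteType D.FunctionField C.FunctionField :=
    Algebra.EssFiniteType.of_comp K _ _
  have h1 := trdeg_add_eq K D.FunctionField (A := C.FunctionField)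
  have hD : Algebra.trdeg K D.FunctionField = 1 := D.trdeg_eq_one
  have hC : Algebra.trdeg K C.FunctionField = 1 := C.trdeg_eq_one
  rw [hD, hC] at h1
  have h2 : Algebra.trdeg D.FunctionField C.FunctionField = 0 :=
    Cardinal.eq_of_add_eq_add_left (h1.trans (add_zero 1).symm) Cardinal.one_lt_aleph0
  have : Algebra.IsAlgebraic D.FunctionField C.FunctionField := trdeg_eq_zero_iff.1 h2
  exact Algebra.finite_of_essFiniteType_of_isAlgebraic

lemma Place.isDiscreteValuationRing {D : Curve K} (q : Place D) :
    IsDiscreteValuationRing q.ring := by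
  let : Algebra K D.FunctionField := D.const.toAlgebra
  have : Algebra.EssFiniteType K D.FunctionField := D.const_essFiniteType
  exact @ValuationSubring.isDiscreteValuationRing_of_trdeg_eq_one _ _ q.ring K _ _ this
    D.trdeg_eq_one q.const_mem q.ne_top

end JordanCurves

end

/-! ### Places over `q` and double cosets -/

noncomputable section

namespace ValuationSubring

variable (R : Type*) {F L : Type*} [CommRing R] [Field F] [Field L] [Algebra R F] [Algebra F L]
  [Algebra R L] [IsScalarTower R F L]

/-- The automorphisms of `L / F` that act trivially on the residues of the elements of `L` that
are integral over `R`. -/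
def inertiaOfIntegral (A : ValuationSubring L) : Subgroup Gal(L/F) where
  carrier := {σ | ∀ x, IsIntegral R x → A.valuation (σ x - x) < 1}
  one_mem' x _ := by simp
  mul_mem' {σ τ} hσ hτ x hx := by
    have h : (σ * τ) x - x = (σ (τ x) - τ x) + (τ x - x) := by simp
    rw [h]
    exact Valuation.map_add_lt _ (hσ _ (hx.map (τ.restrictScalars R))) (hτ x hx)
  inv_mem' {σ} hσ x hx := by
    have h : σ⁻¹ x - x = -(σ (σ⁻¹ x) - σ⁻¹ x) := by
      rw [← AlgEquiv.mul_apply, mul_inv_cancel, AlgEquiv.one_apply, neg_sub]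
    rw [h, Valuation.map_neg]
    exact hσ _ (hx.map (σ⁻¹.restrictScalars R))

variable {R}

/-- The maps `φ ∘ σ` and `φ ∘ τ` on the integral closure agree on the invariants of `Gal(L/M)`, so
they differ by some `η` in that group. Then `σ η τ⁻¹` moves integral elements only by elements that
`φ` kills. Comparing values in `Ω`, not just valuation rings, is what yields inertia instead of
decomposition groups. -/
lemma exists_mul_mem_inertiaOfIntegral {M Ω : Type*} [Field M] [Field Ω] [Algebra F M]
    [Algebra M L] [IsScalarTower F M L] [FiniteDimensional F L] [IsGalois F L]
    [IsDomain R] [IsIntegrallyClosed R] [IsFractionRing R F]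
    (A : ValuationSubring L) (hR : ∀ r, algebraMap R L r ∈ A) (φ : A →+* Ω) [IsLocalHom φ]
    (σ τ : Gal(L/F)) (h : ∀ (m : M) (hσ : σ (algebraMap M L m) ∈ A)
      (hτ : τ (algebraMap M L m) ∈ A), φ ⟨_, hσ⟩ = φ ⟨_, hτ⟩) :
    ∃ η ∈ JordanCurves.galSubgroup F M L, σ * η * τ⁻¹ ∈ A.inertiaOfIntegral R := by
  let T := integralClosure R L
  let := IsIntegralClosure.MulSemiringAction R F L T
  have hsmul (ρ : Gal(L/F)) (t : T) : ((ρ • t : T) : L) = ρ t := algebraMap.coe_smul' ρ t L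
  let inc : T →+* A := (algebraMap T L).codRestrict A.toSubring
    fun t => A.mem_of_isIntegral hR t.2
  let ev (ρ : Gal(L/F)) : T →+* Ω := (φ.comp inc).comp (MulSemiringAction.toRingHom _ T ρ)
  obtain ⟨⟨η, hη⟩, hστ⟩ := MulSemiringAction.exists_forall_eq_smul_of_eq_on_invariants
    (J := JordanCurves.galSubgroup F M L) (φ := ev σ) (ψ := ev τ) (fun x hx => by
      have hxM : (x : L) ∈ (IsScalarTower.toAlgHom F M L).fieldRange := by
        rw [← IsGalois.fixedField_fixingSubgroup (IsScalarTower.toAlgHom F M L).fieldRange,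
          IntermediateField.mem_fixedField_iff]
        intro ρ hρ
        exact (hsmul ρ x).symm.trans (congrArg Subtype.val (hx ⟨ρ, hρ⟩))
      obtain ⟨m, hm⟩ := hxM
      have hm' : algebraMap M L m = x := hm
      have hval (ρ : Gal(L/F)) : ρ (algebraMap M L m) = inc (ρ • x) := by
        rw [hm']; exact (hsmul ρ x).symm
      have hmem (ρ : Gal(L/F)) : ρ (algebraMap M L m) ∈ A := hval ρ ▸ (inc (ρ • x)).2
      have hev (ρ : Gal(L/F)) : ev ρ x = φ ⟨_, hmem ρ⟩ :=
        congrArg φ (Subtype.ext (hval ρ).symm)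
      rw [hev, hev]
      exact h m _ _)
  refine ⟨η, hη, fun x hx => ?_⟩
  let y : T := ⟨τ⁻¹ x, hx.map (τ⁻¹.restrictScalars R)⟩
  have hy := hστ y
  have h1 : φ (inc (σ • η • y) - inc (τ • y)) = 0 := by
    rw [map_sub, sub_eq_zero]
    exact hy.symm
  have h2 : ((inc (σ • η • y) - inc (τ • y) : A) : L) = (σ * η * τ⁻¹) x - x := by
    change ((σ • η • y : T) : L) - ((τ • y : T) : L) = _
    rw [hsmul, hsmul, hsmul]
    change σ (η (τ⁻¹ x)) - (τ * τ⁻¹) x = _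
    rw [mul_inv_cancel]
    rfl
  rw [← h2, ← A.valuation_lt_one_iff, IsLocalRing.mem_maximalIdeal, _root_.mem_nonunits_iff]
  intro hu
  exact (hu.map φ).ne_zero h1

end ValuationSubring

namespace JordanCurves

variable {K : Type u} [Field K] {C D : Curve K}

lemma Place.eval_congr {p p' : Place C} (h : p = p') {x : C.FunctionField} (hx : x ∈ p.ring)
    (hx' : x ∈ p'.ring) : p.eval ⟨x, hx⟩ = p'.eval ⟨x, hx'⟩ := by
  subst h; rfl

section

variable (f : RatMap C D) (q : Place D) {L : Type u} [Field L] (A : ValuationSubring L)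
  (φ : A →+* AlgebraicClosure K) [IsLocalHom φ] (ι : C.FunctionField →+* L)
  (hA : A.comap (ι.comp f.pullback) = q.ring)
  (hφ : ∀ (x) (hx : x ∈ q.ring) (hx' : ι (f.pullback x) ∈ A), φ ⟨_, hx'⟩ = q.eval ⟨x, hx⟩)

/-- The place of `C` that is induced by an embedding `ι` of `K(C)` into a field `L` with a place
extending the place `q` of `D`. -/
def Place.ofEmbedding : Place C where
  ring := A.comap ι
  const_mem c := by
    rw [← f.pullback_const]
    exact (hA.symm ▸ q.const_mem c : D.const c ∈ A.comap (ι.comp f.pullback))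
  ne_top h := by
    apply q.ne_top
    rw [← hA, ← ValuationSubring.comap_comap, h]
    ext; simp
  eval := φ.comp (belowHom ι A)
  isLocalHom := inferInstance
  eval_const c := by
    have h : D.const c ∈ A.comap (ι.comp f.pullback) := hA.symm ▸ q.const_mem c
    rw [← q.eval_const c, ← hφ _ (q.const_mem c) h]
    exact congrArg φ (Subtype.ext (congrArg ι (f.pullback_const c).symm))

lemma Place.ofEmbedding_liesOver : (Place.ofEmbedding f q A φ ι hA hφ).LiesOver f q :=
  ⟨hA, fun _ hx _ => hφ _ hx _⟩

end

/-- The Galois group of a Galois extension of the base field of a cover with a tamely ramified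
place lying under at most two places has a cyclic subgroup with at most two cosets. -/
lemma exists_isCyclic_twoCosets (f : RatMap C D) (q : Place D) (hq : q.IsTame f)
    (hcard : {p : Place C | p.LiesOver f q}.encard ≤ 2)
    (L : Type u) [Field L] [Algebra D.FunctionField L]
    [FiniteDimensional D.FunctionField L] [IsGalois D.FunctionField L]
    [Algebra D.FunctionField C.FunctionField] [Algebra C.FunctionField L]
    [IsScalarTower D.FunctionField C.FunctionField L]
    (hf : algebraMap D.FunctionField C.FunctionField = f.pullback) :
    ∃ (Z : Subgroup Gal(L/D.FunctionField)) (x : Gal(L/D.FunctionField)), IsCyclic Z ∧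
      TwoOrbits.TwoCosets Z (galSubgroup D.FunctionField C.FunctionField L) ⊤ x := by
  have : IsDiscreteValuationRing q.ring := q.isDiscreteValuationRing
  have := q.isLocalHom
  obtain ⟨A, φ, hlφ, hA, hφ⟩ := ValuationSubring.exists_extension_of_place (L := L) q.ring
    q.ne_top q.eval
  let : Algebra q.ring L :=
    ((algebraMap D.FunctionField L).comp (algebraMap q.ring D.FunctionField)).toAlgebra
  have : IsScalarTower q.ring D.FunctionField L := .of_algebraMap_eq' rfl
  have hR (r : q.ring) : algebraMap q.ring L r ∈ A := by
    have h : (r : D.FunctionField) ∈ A.comap (algebraMap D.FunctionField L) := by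
      rw [hA]
      exact r.2
    exact h
  have hAtop : A ≠ ⊤ := by
    rintro rfl
    apply q.ne_top
    rw [← hA]
    ext; simp
  let ι (σ : Gal(L/D.FunctionField)) : C.FunctionField →+* L :=
    (σ : L →+* L).comp (algebraMap C.FunctionField L)
  have hι (σ : Gal(L/D.FunctionField)) :
      (ι σ).comp f.pullback = algebraMap D.FunctionField L := by
    ext x
    change σ (algebraMap C.FunctionField L (f.pullback x)) = _
    rw [← hf, ← IsScalarTower.algebraMap_apply, σ.commutes]
  -- The place of `C` seen through the embedding `σ` of `K(C)` in `L`; equality of two such places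
  -- forces equality of double cosets of `I` and `H`.
  let p (σ : Gal(L/D.FunctionField)) : Place C := Place.ofEmbedding f q A φ (ι σ)
    (by rw [hι]; exact hA) (fun x hx hx' => by
      have h : ι σ (f.pullback x) = algebraMap D.FunctionField L x := congrArg (· x) (hι σ)
      have hx'' : algebraMap D.FunctionField L x ∈ A := by rwa [← h]
      rw [← hφ x hx hx'']
      exact congrArg φ (Subtype.ext h))
  have hp (σ) : (p σ).LiesOver f q := Place.ofEmbedding_liesOver ..
  set H := galSubgroup D.FunctionField C.FunctionField L
  let I : Subgroup Gal(L/D.FunctionField) := A.inertiaOfIntegral q.ring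
  have key (σ τ : Gal(L/D.FunctionField)) (h : p σ = p τ) :
      ∃ i ∈ I, ∃ η ∈ H, τ = i * σ * η := by
    obtain ⟨η, hη, hi⟩ := A.exists_mul_mem_inertiaOfIntegral (M := C.FunctionField) hR φ σ τ
      (fun m hσ hτ => Place.eval_congr h (x := m) hσ hτ)
    exact ⟨_, inv_mem hi, η, hη, by group⟩
  obtain ⟨x, hx⟩ : ∃ x, ∀ τ, p τ = p 1 ∨ p τ = p x := by
    by_cases hall : ∀ τ, p τ = p 1
    · exact ⟨1, fun τ => Or.inl (hall τ)⟩
    · push Not at hall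
      obtain ⟨x, hx⟩ := hall
      refine ⟨x, fun τ => ?_⟩
      by_contra! h
      have h3 : ({p 1, p x, p τ} : Set (Place C)).encard = 3 :=
        Set.encard_eq_three.2 ⟨_, _, _, hx.symm, h.1.symm, h.2.symm, rfl⟩
      have h4 : ({p 1, p x, p τ} : Set (Place C)) ⊆ {p : Place C | p.LiesOver f q} := by
        rintro _ (rfl | rfl | rfl) <;> exact hp _
      have h5 := (Set.encard_le_encard h4).trans hcard
      rw [h3] at h5
      exact absurd h5 (by decide)
  obtain ⟨g, -, hg⟩ := ValuationSubring.exists_forall_zpow_mul_mem_wildInertia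
    (F := D.FunctionField) A hR hAtop I (fun σ hσ x hx => hσ x hx)
  -- `σ⁻¹ w σ` is wild for the valuation ring `σ⁻¹(A)`, which also lies over `q`. This is why
  -- tameness is needed at all valuation rings over `q`.
  have hwild (σ w : Gal(L/D.FunctionField))
      (hw : w ∈ A.valuation.wildInertia Gal(L/D.FunctionField)) : σ⁻¹ * w * σ ∈ H := by
    have hcomap : (A.comap (σ : L →+* L)).comap (algebraMap D.FunctionField L) = q.ring := by
      rw [← hA, ValuationSubring.comap_comap]
      congr 1
      ext x
      exact σ.commutes x
    refine mem_galSubgroup_of_mem_wildInertia (R := q.ring) (A.comap (σ : L →+* L))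
      (fun r => ?_) ?_ (fun l hl => ?_) ?_ ?_
    · exact ValuationSubring.mem_comap.1 (hcomap.symm ▸ r.2)
    · rw [hcomap]
      exact q.ne_top
    -- If `l` is nonzero in `K`, its inverse is a constant and lies in the valuation ring, so `l`
    -- cannot have valuation below 1.
    · by_contra hl0
      have hlK : (l : K) ≠ 0 := fun h => hl0 (by
        rw [← map_natCast D.const, h, map_zero])
      have h1 : algebraMap D.FunctionField L (D.const (l : K)⁻¹) ∈ A.comap (σ : L →+* L) :=
        ValuationSubring.mem_comap.1 (hcomap.symm ▸ q.const_mem _)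
      rw [ValuationSubring.valuation_lt_one_iff_inv_notMem] at hl
      rw [map_inv₀, map_inv₀, map_natCast, map_natCast] at h1
      rcases hl with hl | hl
      · apply hl0
        apply (algebraMap D.FunctionField L).injective
        rw [map_natCast, hl, map_zero]
      · exact hl h1
    · rw [hf]
      apply hq
      rw [ValuationSubring.comap_comap, ← hf, ← IsScalarTower.algebraMap_eq, hcomap]
    · intro x hx0
      rw [ValuationSubring.valuation_comap_lt_iff]
      have h1 := hw (σ x) (by simpa using hx0)
      have h2 : (σ : L →+* L) ((σ⁻¹ * w * σ) • x - x) = w • (σ x) - σ x := by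
        rw [map_sub]
        congr 1
        change (σ * (σ⁻¹ * w * σ)) x = (w * σ) x
        congr 1
        group
      rw [h2]
      exact h1
  have hprod (τ σ : Gal(L/D.FunctionField)) (h : p τ = p σ) :
      ∃ z ∈ Subgroup.zpowers g, ∃ η ∈ H, τ = z * σ * η := by
    obtain ⟨i, hi, η, hη, rfl⟩ := key σ τ h.symm
    obtain ⟨k, hk⟩ := hg i hi
    -- With `i = g ^ k w` and `w` wild, `i σ η = g ^ k σ (σ⁻¹ w σ) η`: the wild part moves past `σ`
    -- into `H`.
    refine ⟨g ^ k, ⟨k, rfl⟩, (σ⁻¹ * ((g ^ k)⁻¹ * i) * σ) * η, mul_mem (hwild σ _ hk) hη, ?_⟩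
    group
  refine ⟨Subgroup.zpowers g, x, inferInstance, fun τ _ => ?_⟩
  refine (hx τ).imp (fun h => ?_) fun h => hprod τ x h
  obtain ⟨z, hz, η, hη, hτ⟩ := hprod τ 1 h
  exact ⟨z, hz, η, hη, by rw [hτ, mul_one]⟩

/-- A finite separable extension is contained in a finite Galois extension. -/
lemma exists_isGalois {F M : Type u} [Field F] [Field M] [Algebra F M]
    [FiniteDimensional F M] [Algebra.IsSeparable F M] :
    ∃ (L : Type u) (_ : Field L) (_ : Algebra F L) (_ : Algebra M L), IsScalarTower F M L ∧
      FiniteDimensional F L ∧ IsGalois F L := by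
  have : Algebra.IsSeparable F (IntermediateField.normalClosure F M (AlgebraicClosure M)) := by
    have h (g : M →ₐ[F] AlgebraicClosure M) : Algebra.IsSeparable F g.fieldRange :=
      AlgEquiv.Algebra.isSeparable (AlgEquiv.ofInjectiveField g)
    unfold IntermediateField.normalClosure
    infer_instance
  exact ⟨IntermediateField.normalClosure F M (AlgebraicClosure M), inferInstance, inferInstance, inferInstance,
    inferInstance, inferInstance, { }⟩

end JordanCurves

end

/-! ### The theorem -/

theorem corollary1p5 {K : Type u} [Field K] (C D : JordanCurves.Curve K)
    (hC : C.IsNice) (hD : D.IsNice)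
    (f : JordanCurves.RatMap C D) (hf : f.IsSeparable)
    (hplace : ∃ q : JordanCurves.Place D,
      q.IsTame f ∧ {p : JordanCurves.Place C | p.LiesOver f q}.encard ≤ 2)
    (a b : List ℕ)
    (ha : JordanCurves.IsMaximalDecomposition f a)
    (hb : JordanCurves.IsMaximalDecomposition f b) :
    a.length = b.length ∧ a.Perm b := by
  obtain ⟨q, hq, hcard⟩ := hplace
  let : Algebra D.FunctionField C.FunctionField := f.pullback.toAlgebra
  have : FiniteDimensional D.FunctionField C.FunctionField := f.finiteDimensional
  have : Algebra.IsSeparable D.FunctionField C.FunctionField := hf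
  obtain ⟨L, _, _, _, _, _, _⟩ := JordanCurves.exists_isGalois (F := D.FunctionField)
    (M := C.FunctionField)
  obtain ⟨Z, x, hZ, hx⟩ := JordanCurves.exists_isCyclic_twoCosets f q hq hcard L rfl
  have hperm : a.Perm b := Multiset.coe_eq_coe.1
    ((ha.maxChain L rfl).unique (hb.maxChain L rfl) ⟨Z, x, hZ, le_top, hx⟩)
  exact ⟨hperm.length_eq, hperm⟩
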